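/- Let $d\ge 1$ and $m>n\ge 1$ be integers with $\gcd(n,m)=1$, and write $[0,k]=\{0,1,\dots,k\}$, $\mathbb N=\{0,1,2,\dots\}$. **Subsets.** Let $\Gamma\subset\mathbb N$ be the semigroup (with $0$) generated by $dn,\,dm,\,dmn+1$, and $\delta=|\mathbb N\setminus\Gamma|$. For $\Delta\subset\mathbb N$ closed under adding $dn$, let $A(\Delta)=\{a\in\Delta: a-dn\notin\Delta\}$ be its set of $dn$-generators. $\Delta$ is *admissible* if for every $0\le i\le d-1$ there is $a\in A(\Delta)$ with $a\equiv i \pmod d$ and $a+dm+1\in\Delta$. Let $\mathcal Adm(dn,dm)$ be the set of admissible $\Delta\subset\mathbb N$ with $0\in\Delta$ and $\Gamma+\Delta\subset\Delta$. For such $\Delta$ put $e(\Delta)=\delta-|\mathbb N\setminus\Delta|$ and $\dim\Delta=\sum_{a\in A(\Delta)}|[a,\infty)\setminus\Delta|-\sum_{a\in A(\Delta)}|[a+dm,\infty)\setminus\Delta|$. Put $\hat a_{i,j}=jdm+(dmn+1)i$ and $a_{i,j}=\lfloor \hat a_{i,j}/(dn)\rfloor$. An integer matrix $(c_{i,j})_{0\le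 i\le d-1,\,0\le j\le n-1}$ corresponds to $\Delta$, written $\Delta\cong(c_{i,j})$, if $A(\Delta)=\{\hat a_{i,j}-dn\,c_{i,j}\}$. **Dyck paths.** A $(dn,dm)$-Dyck path is an integer matrix $D=(y_{i,j})_{0\le i\le d-1,\,0\le j\le n-1}$, also written $y_{in+j}=y_{i,j}$, with $0\le y_{i,j}\le a_{i,j}$ and $y_0\le y_1\le\dots\le y_{dn-1}$; $\mathcal Y(dn,dm)$ is the set of these. Let $|D|=\sum y_{i,j}$. Put $\mathcal R^+=\{(x,y)\in\mathbb Z^2:0\le x\le dn-1,\ 1\le y\le \frac mn x\}$ and $\overline{\mathcal R}^+=\{(x,y)\in\mathbb Z^2:0\le x\le dn-1,\ y\le\frac mn x\}$, and identify $D$ with $\{(x,y)\in\mathcal R^+: y\le y_x\}$. For $z=(x,y)\in D$ let $\mathfrak a(z)=\#\{0\le x'<x: y\le y_{x'}\}$ and $\mathfrak l(z)=y_x-y$, and let $$\mathrm{dinv}(D)=\#\Bigl\{z\in D:\tfrac{\mathfrak l(z)}{\mathfrak a(z)+1}\le\tfrac mn<\tfrac{\mathfrak l(z)+1}{\mathfrak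 a(z)}\Bigr\}$$ (the second inequality holds by convention if $\mathfrak a(z)=0$), $\text{co-dinv}(D)=\delta-\mathrm{dinv}(D)$. Let $\mathrm{rk}(x,y)=mx-ny$. **Permutations.** For a sequence $(p_u)_{1\le u\le d-1}$ with $p_u\le un$ and $0\le j\le n-1$, let $i_{j,u}=\min\{0\le i\le u: in+j\ge p_u\}$, let $s_{j,u}$ be the cycle $(i_{j,u}\ \ i_{j,u}{+}1\ \cdots\ u)$ on $[0,d-1]$ (so $i\mapsto i+1$ for $i_{j,u}\le i<u$, and $u\mapsto i_{j,u}$), and $s_j=s_{j,d-1}\circ\cdots\circ s_{j,1}$. **The map $\Psi_d$.** Given $D=(y_{i,j})\in\mathcal Y(dn,dm)$ let $\mathrm{rk}^{[0]}_x=mx-ny_x$ ($0\le x<dn$). For $u=d-1,d-2,\dots,1$ let $$p_u=\max\{0\le x\le un:\ \mathrm{rk}^{[d-u-1]}_x\le \mathrm{rk}^{[d-u-1]}_{x+n-1}+m\},$$ and let $\mathrm{rk}^{[d-u]}$ (of length $un$) be obtained from $\mathrm{rk}^{[d-u-1]}$ by deleting the entries with indices $p_u,\dots,p_u+n-1$.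 With the permutations $s_j$ of $(p_u)$, let $\Psi_d(D)\cong(c_{i,j})$ with $c_{i,j}=y_{s_j(i),j}-(s_j(i)-i)m$, that is, $\Psi_d(D)=\bigcup_{i,j}\bigl(\hat a_{i,j}-dn\,c_{i,j}+dn\mathbb N\bigr)$. The enhanced rank of $D$ is $\widehat{\mathrm{rk}}_D(in+j,y)=d\cdot\mathrm{rk}(in+j,y)+s_j^{-1}(i)$ for $0\le i\le d-1$, $0\le j\le n-1$, $y\in\mathbb Z$. **The map $\Phi_d$.** Given $\Delta\cong(c_{i,j})\in\mathcal Adm(dn,dm)$ let $r^{[0]}_{in+j}=m(in+j)-nc_{i,j}$. For $u=1,\dots,d-1$ let $$\tilde p_u=\max\{in+j+1:\ 0\le i\le u-1,\ 0\le j\le n-1,\ r^{[u-1]}_{un+((j+1)\bmod n)}\le r^{[u-1]}_{in+j}+m\},$$ and, for $0\le x=in+j<dn$, let $r^{[u]}_x=r^{[u-1]}_x$ if $x<\tilde p_u$ or $x\ge(u+1)n$; $r^{[u]}_x=r^{[u-1]}_{x-n}$ if $\tilde p_u+n\le x<(u+1)n$; $r^{[u]}_x=r^{[u-1]}_{un+j}$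 if $\tilde p_u\le x<\tilde p_u+n$. With the permutations $\tilde s_j$ of $(\tilde p_u)$, let $\Phi_d(\Delta)$ be the matrix with entries $c_{\sigma_j(i),j}-(\sigma_j(i)-i)m$, $\sigma_j=\tilde s_j^{-1}$. **Theorem.** (1) For every $D\in\mathcal Y(dn,dm)$ the maxima defining the move indices $p_u$ exist, and $0<p_1<p_2<\dots<p_{d-1}\le(d-1)n$. (2) $\mathcal Adm(dn,dm)$ is also the set of admissible $\Delta\subset\mathbb N$ with $0\in\Delta$ that are closed under adding $dn$ and $dm$. For every $\Delta\in\mathcal Adm(dn,dm)$ there is a matrix $(c_{i,j})$ with $\Delta\cong(c_{i,j})$, and the maxima defining $\tilde p_u$ exist. The map $\Psi_d$ is a bijection $\mathcal Y(dn,dm)\to\mathcal Adm(dn,dm)$, with inverse $\Phi_d$. For $D\in\mathcal Y(dn,dm)$ and $\Delta=\Psi_d(D)\cong(c_{i,j})$, the matrix of $\Delta$ is the matrix $(c_{i,j})$ defined from $D$ above, and $$e(\Delta)=\sum_{i,j}c_{i,j}=|D|,\qquad \dim\Delta=\text{co-dinv}(D).$$ (3) For every $D\in\mathcal Y(dn,dm)$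 the enhanced rank is a bijection $\widehat{\mathrm{rk}}_D:\overline{\mathcal R}^+\to\mathbb N$ with $\lfloor\widehat{\mathrm{rk}}_D/d\rfloor=\mathrm{rk}$, and $\widehat{\mathrm{rk}}_D(\mathcal R^+\setminus D)=\mathbb N\setminus\Psi_d(D)$. -/

import Mathlib

open Set

namespace DyckAdm

/-! ### Semigroup, semimodules, admissible subsets -/

/-- The semigroup `Γ ⊆ ℕ` generated by `dn`, `dm`, `dmn+1` (the semigroup of valuations of the
curve `x = t^(dn)`, `y = t^(dm) + λ t^(dm+1) + ⋯` with `λ ≠ 0`). -/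
def valueSemigroup (d n m : ℕ) : AddSubmonoid ℕ :=
  AddSubmonoid.closure {d * n, d * m, d * m * n + 1}

/-- `δ(Δ) = |ℕ ∖ Δ|`. -/
noncomputable def deltaInv (Δ : Set ℕ) : ℤ := (Δᶜ.ncard : ℤ)

/-- `δ = |ℕ ∖ Γ|`. -/
noncomputable def delta (d n m : ℕ) : ℤ := deltaInv (valueSemigroup d n m : Set ℕ)

/-- `e(Δ) = δ - δ(Δ)`. -/
noncomputable def eInv (d n m : ℕ) (Δ : Set ℕ) : ℤ := delta d n m - deltaInv Δ

/-- The set `A(Δ)` of `N`-generators of an `N`-invariant `Δ ⊆ ℕ`: the elements `a` of `Δ` such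
that `a - N` is not in `Δ`. -/
def generators (N : ℕ) (Δ : Set ℕ) : Set ℕ := {a | a ∈ Δ ∧ ¬ ∃ b ∈ Δ, a = b + N}

/-- `Δ` is admissible: every `i ∈ {0, …, d-1}` is admissible, that is, there is `a ∈ A(Δ)` with
`a ≡ i (mod d)` and `a + dm + 1 ∈ Δ`. -/
def IsAdmissible (d n m : ℕ) (Δ : Set ℕ) : Prop :=
  ∀ i < d, ∃ a ∈ generators (d * n) Δ, a ≡ i [MOD d] ∧ a + d * m + 1 ∈ Δ

/-- `Adm(dn,dm)`: the admissible `0`-normalized `Γ`-semimodules `Δ ⊆ ℕ`. -/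
def admissibleSubsets (d n m : ℕ) : Set (Set ℕ) :=
  {Δ | 0 ∈ Δ ∧ (∀ g ∈ valueSemigroup d n m, ∀ b ∈ Δ, g + b ∈ Δ) ∧ IsAdmissible d n m Δ}

/-- `Gaps(a) = [a,∞) ∖ Δ`. -/
def gaps (Δ : Set ℕ) (a : ℕ) : Set ℕ := {b | a ≤ b ∧ b ∉ Δ}

/-- `dim Δ = ∑_{a ∈ A(Δ)} |Gaps(a)| - ∑_{a ∈ A(Δ)} |Gaps(a+dm)|`. -/
noncomputable def dimSub (d n m : ℕ) (Δ : Set ℕ) : ℤ :=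
  (∑ᶠ a ∈ generators (d * n) Δ, ((gaps Δ a).ncard : ℤ)) -
    ∑ᶠ a ∈ generators (d * n) Δ, ((gaps Δ (a + d * m)).ncard : ℤ)

/-! ### The identification of subsets with matrices -/

/-- `â_{i,j} = jdm + (dmn+1)i`. -/
def aHat (d n m i j : ℕ) : ℤ := j * (d * m) + (d * m * n + 1) * i

/-- `a_{i,j} = ⌊â_{i,j} / (dn)⌋`. -/
def aFloor (d n m i j : ℕ) : ℤ := aHat d n m i j / (d * n)

/-- The subset `⋃_{i,j} (â_{i,j} - dn c_{i,j} + dn ℕ)` (its part in `ℕ`) attached to a matrix. -/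
def toSubset (d n m : ℕ) (c : Fin d → Fin n → ℤ) : Set ℕ :=
  {a | ∃ (i : Fin d) (j : Fin n) (k : ℕ), (a : ℤ) = aHat d n m i j - d * n * c i j + d * n * k}

/-- The matrix `(c_{i,j})` of `Δ`, where `â_{i,j} - dn c_{i,j}` is the `dn`-generator of `Δ` that is
congruent to `â_{i,j}` modulo `dn`. -/
noncomputable def toMatrix (d n m : ℕ) (Δ : Set ℕ) : Fin d → Fin n → ℤ := fun i j =>
  (aHat d n m i j -
    (sInf {a : ℕ | a ∈ generators (d * n) Δ ∧ (a : ℤ) ≡ aHat d n m i j [ZMOD (d * n : ℤ)]} : ℕ)) /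
      (d * n)

/-- Sum of the entries of a matrix. -/
def size {d n : ℕ} (y : Fin d → Fin n → ℤ) : ℤ := ∑ i, ∑ j, y i j

/-- Entry `(i,j)` with natural number indices (`0` outside the range). -/
def entry {d n : ℕ} (y : Fin d → Fin n → ℤ) (i j : ℕ) : ℤ :=
  if h : i < d ∧ j < n then y ⟨i, h.1⟩ ⟨j, h.2⟩ else 0

/-- `y_x = y_{i,j}` for `x = in + j`. -/
def flat {d n : ℕ} (y : Fin d → Fin n → ℤ) (x : ℕ) : ℤ := entry y (x / n) (x % n)

/-! ### Dyck paths and boxes -/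

/-- `(dn,dm)`-Dyck paths, as Young diagrams with column heights `y_0 ≤ ⋯ ≤ y_{dn-1}`,
`0 ≤ y_x ≤ a_x`. -/
def dyckPaths (d n m : ℕ) : Set (Fin d → Fin n → ℤ) :=
  {y | (∀ i j, 0 ≤ y i j ∧ y i j ≤ aFloor d n m i j) ∧
    ∀ x, x + 1 < d * n → flat y x ≤ flat y (x + 1)}

/-- `rk(x,y) = mx - ny`; a box is identified with its top-left vertex `(x,y)`. -/
def rk (n m : ℕ) (z : ℕ × ℤ) : ℤ := m * z.1 - n * z.2

/-- Boxes in the triangle with vertices `(0,0)`, `(dn,0)`, `(dn,dm)`. -/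
def trianglePlus (d n m : ℕ) : Set (ℕ × ℤ) :=
  {z | z.1 < d * n ∧ 1 ≤ z.2 ∧ n * z.2 ≤ m * z.1}

/-- The extended region: boxes with `0 ≤ x ≤ dn-1` and `y ≤ (m/n) x`. -/
def extendedRegion (d n m : ℕ) : Set (ℕ × ℤ) :=
  {z | z.1 < d * n ∧ n * z.2 ≤ m * z.1}

/-- The boxes of the Young diagram with column heights `y_x`. -/
def boxes {d n : ℕ} (y : Fin d → Fin n → ℤ) : Set (ℕ × ℤ) :=
  {z | z.1 < d * n ∧ 1 ≤ z.2 ∧ z.2 ≤ flat y z.1}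

/-- Arm length: the number of boxes of the diagram to the left of the box, in the same row. -/
def arm {d n : ℕ} (y : Fin d → Fin n → ℤ) (z : ℕ × ℤ) : ℕ :=
  ((Finset.range z.1).filter fun x => z.2 ≤ flat y x).card

/-- Leg length: the number of boxes of the diagram above the box, in the same column. -/
def leg {d n : ℕ} (y : Fin d → Fin n → ℤ) (z : ℕ × ℤ) : ℤ := flat y z.1 - z.2

/-- `dinv(D) = #{z ∈ D : l(z)/(a(z)+1) ≤ m/n < (l(z)+1)/a(z)}`, with denominators cleared
(the second condition holds when `a(z) = 0`). -/
noncomputable def dinv {d n : ℕ} (m : ℕ) (y : Fin d → Fin n → ℤ) : ℕ :=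
  {z | z ∈ boxes y ∧ n * leg y z ≤ m * (arm y z + 1) ∧ m * arm y z < n * (leg y z + 1)}.ncard

/-- `co-dinv(D) = δ - dinv(D)`. -/
noncomputable def codinv {d n : ℕ} (m : ℕ) (y : Fin d → Fin n → ℤ) : ℤ :=
  delta d n m - dinv m y

/-! ### Permutations attached to a sequence of move indices -/

/-- The cycle `(i i+1 ⋯ u)`, i.e. `i ↦ i+1 ↦ ⋯ ↦ u ↦ i` (all other numbers are fixed). -/
def cyc (i u : ℕ) : Equiv.Perm ℕ where
  toFun a := if i ≤ a ∧ a < u then a + 1 else if a = u ∧ i ≤ u then i else a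
  invFun a := if i < a ∧ a ≤ u then a - 1 else if a = i ∧ i ≤ u then u else a
  left_inv a := by grind
  right_inv a := by grind

/-- The permutation index `i_{j,u} = min {0 ≤ i ≤ u : in + j ≥ p_u}`. -/
noncomputable def permIndex (n : ℕ) (p : ℕ → ℕ) (j u : ℕ) : ℕ :=
  sInf {i | i ≤ u ∧ p u ≤ i * n + j}

/-- `s_{j,k} ∘ ⋯ ∘ s_{j,1}` with `s_{j,u} = (i_{j,u} ⋯ u)`. It fixes every number above `k`. -/
noncomputable def permComp (n : ℕ) (p : ℕ → ℕ) (j : ℕ) : ℕ → Equiv.Perm ℕ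
  | 0 => 1
  | k + 1 => cyc (permIndex n p j (k + 1)) (k + 1) * permComp n p j k

/-! ### From Dyck paths to admissible subsets -/

/-- The set whose maximum is the move index `p_u`, for a rank vector `r`. -/
def moveSet (n m : ℕ) (r : ℕ → ℤ) (u : ℕ) : Set ℕ := {x | x ≤ u * n ∧ r x ≤ r (x + n - 1) + m}

/-- The rank vectors `rk^{[k]}` of `D`; the entries `x < (d-k)n` are the meaningful ones.
The vector `rk^{[k+1]} = rk^{[d-u]}`, `u = d-1-k`, arises from `rk^{[k]}` by deleting the `n` entries
that start at the position `p_u = max (moveSet …)`. -/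
noncomputable def rankVec (d n m : ℕ) (y : Fin d → Fin n → ℤ) : ℕ → ℕ → ℤ
  | 0 => fun x => rk n m (x, flat y x)
  | k + 1 => fun x =>
      if x < sSup (moveSet n m (rankVec d n m y k) (d - 1 - k)) then rankVec d n m y k x
      else rankVec d n m y k (x + n)

/-- The move index `p_u`, `1 ≤ u ≤ d-1`. -/
noncomputable def moveIndex (d n m : ℕ) (y : Fin d → Fin n → ℤ) (u : ℕ) : ℕ :=
  sSup (moveSet n m (rankVec d n m y (d - u - 1)) u)

/-- `s_j = s_{j,d-1} ∘ ⋯ ∘ s_{j,1}`. -/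
noncomputable def sPerm (d n m : ℕ) (y : Fin d → Fin n → ℤ) (j : ℕ) : Equiv.Perm ℕ :=
  permComp n (moveIndex d n m y) j (d - 1)

/-- The matrix `c_{i,j} = y_{s_j(i),j} - (s_j(i) - i) m`. -/
noncomputable def psiMatrix (d n m : ℕ) (y : Fin d → Fin n → ℤ) : Fin d → Fin n → ℤ := fun i j =>
  entry y (sPerm d n m y j i) j - ((sPerm d n m y j i : ℤ) - (i : ℕ)) * m

/-- `Ψ_d`, with values in subsets of `ℕ`. -/
noncomputable def psi (d n m : ℕ) (y : Fin d → Fin n → ℤ) : Set ℕ :=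
  toSubset d n m (psiMatrix d n m y)

/-- The enhanced rank: `d · rk(x,y) + s_j⁻¹(i)` for `x = in + j`. -/
noncomputable def enhancedRank (d n m : ℕ) (y : Fin d → Fin n → ℤ) (z : ℕ × ℤ) : ℤ :=
  d * rk n m z + (((sPerm d n m y (z.1 % n))⁻¹ (z.1 / n) : ℕ) : ℤ)

/-! ### From admissible subsets to Dyck paths -/

/-- The set whose maximum is the move index `p̃_u`, for a rank vector `r`. -/
def tildeMoveSet (n m : ℕ) (r : ℕ → ℤ) (u : ℕ) : Set ℕ :=
  {x | ∃ i j, i < u ∧ j < n ∧ x = i * n + j + 1 ∧ r (u * n + (j + 1) % n) ≤ r (i * n + j) + m}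

/-- The rank vectors `rk_Δ^{[u]}`, where `Δ ≅ (c_{i,j})`. -/
noncomputable def tildeRankVec (d n m : ℕ) (c : Fin d → Fin n → ℤ) : ℕ → ℕ → ℤ
  | 0 => fun x => rk n m (x, flat c x)
  | u + 1 => fun x =>
      let r := tildeRankVec d n m c u
      let p := sSup (tildeMoveSet n m r (u + 1))
      if x < p ∨ (u + 2) * n ≤ x then r x
      else if p + n ≤ x then r (x - n)
      else r ((u + 1) * n + x % n)

/-- The move index `p̃_u`, `1 ≤ u ≤ d-1`. -/
noncomputable def tildeMoveIndex (d n m : ℕ) (c : Fin d → Fin n → ℤ) (u : ℕ) : ℕ :=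
  sSup (tildeMoveSet n m (tildeRankVec d n m c (u - 1)) u)

/-- `s̃_j = s̃_{j,d-1} ∘ ⋯ ∘ s̃_{j,1}`. -/
noncomputable def tildeSPerm (d n m : ℕ) (c : Fin d → Fin n → ℤ) (j : ℕ) : Equiv.Perm ℕ :=
  permComp n (tildeMoveIndex d n m c) j (d - 1)

/-- The matrix with entries `c_{σ(i),j} - (σ(i) - i) m`, where `σ = s̃_j⁻¹`. -/
noncomputable def phiMatrix (d n m : ℕ) (c : Fin d → Fin n → ℤ) : Fin d → Fin n → ℤ := fun i j =>
  entry c ((tildeSPerm d n m c j)⁻¹ i) j - ((((tildeSPerm d n m c j)⁻¹ i : ℕ) : ℤ) - (i : ℕ)) * m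

/-- `Φ_d`, defined on subsets of `ℕ` through their matrices. -/
noncomputable def phi (d n m : ℕ) (Δ : Set ℕ) : Fin d → Fin n → ℤ :=
  phiMatrix d n m (toMatrix d n m Δ)

end DyckAdm

/-! A matrix is encoded by the ranks `q x = m x - n c_x` of its columns. Since `n` and `m` are
coprime, the residue of `q x` modulo `n` determines `x` modulo `n`, and the generator with index
`(i,j)` is `d * q (i n + j) + i`: its residue modulo `d` names a layer, its quotient is a rank. Both
sides of the bijection thus become sequences of `d n` nonnegative ranks that start with `0`. A Dyck
path is one long path whose rank rises by at most `m` at every step. An admissible subset is a list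
of `d` blocks of length `n`: invariance under `dm` says that each block, read cyclically, rises by
at most `m` at every step, and admissibility says that some entry of each block may be followed by
an entry of the next block.

A path is dismantled from the right. A window of `n` consecutive entries that closes up is a cyclic
block. When the last such window is deleted, a path remains, because behind its start entries at
distance `n` decrease. Conversely, a cyclic block is inserted as far to the right as a step from the
preceding entry allows. Each of these extremal choices recovers the other
(`Glue.isGreatest_tildeMoveSet`, `Glue.isGreatest_moveSet`), and the links between consecutive
blocks correspond to the growth of the move indices (`layeredPath_of_path`,
`layeredPath_of_admissible`, `LayeredPath.linkedBlock`). Hence the two maps are mutually inverse.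

Ranks are only permuted, so the size is preserved. Both `dim` and co-dinv are sums over pairs of
ranks: a part blind to the order, plus order terms, taken over pairs in different layers
(`dimSub_layerSet_eq`) or over pairs of columns (`codinv_eq`). An order term sees only differences
congruent to `0` or `m` modulo `n`. It vanishes inside a cyclic block, and the terms of an entry
with a block that jumps over it add up to zero in either order (`sum_orderTerm_after`). So moving a
block does not change the order sum (`Glue.positionSum_eq`).

For the enhanced rank, each column, read downwards, is an arithmetic progression of difference `dn`,
and the top of the diagram in that column corresponds to a generator. -/

namespace DyckAdm

section

/-! ### Coordinates on the integers given by a rank sequence -/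

/-- The rank of the top-left vertex of the top box of the column `x`. -/
def colRank {d : ℕ} (n m : ℕ) (c : Fin d → Fin n → ℤ) (x : ℕ) : ℤ := rk n m (x, flat c x)

/-- A sequence of integers with `q x ≡ m x (mod n)` for `x < L`. -/
def ResidueSeq (n m L : ℕ) (q : ℕ → ℤ) : Prop := ∀ x < L, (n : ℤ) ∣ q x - m * x

/-- The subset of `ℕ` whose `i`-th layer is generated by the block `q (i n), …, q (i n + n - 1)`. -/
def layerSet (d n : ℕ) (q : ℕ → ℤ) : Set ℕ :=
  {a | ∃ x < d * n, ∃ k : ℕ, (a : ℤ) = d * (q x + n * k) + (x / n : ℕ)}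

/-- The `x`-th generator of `layerSet d n q`. -/
def layerGen (d n : ℕ) (q : ℕ → ℤ) (x : ℕ) : ℕ := (d * q x + (x / n : ℕ)).toNat

lemma flat_mul_add {d n : ℕ} (c : Fin d → Fin n → ℤ) (i : Fin d) (j : Fin n) :
    flat c (i * n + j) = c i j := by
  have hj := j.2
  have h1 : (i * n + j : ℕ) / n = i := by
    rw [mul_comm, Nat.mul_add_div (by omega), Nat.div_eq_of_lt hj, add_zero]
  have h2 : (i * n + j : ℕ) % n = j := by
    rw [mul_comm, Nat.mul_add_mod, Nat.mod_eq_of_lt hj]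
  simp [flat, entry, h1, h2]

lemma entry_eq_flat {d n : ℕ} (c : Fin d → Fin n → ℤ) {i j : ℕ} (hj : j < n) :
    entry c i j = flat c (i * n + j) := by
  have h1 : (i * n + j : ℕ) / n = i := by
    rw [mul_comm, Nat.mul_add_div (by omega), Nat.div_eq_of_lt hj, add_zero]
  have h2 : (i * n + j : ℕ) % n = j := by
    rw [mul_comm, Nat.mul_add_mod, Nat.mod_eq_of_lt hj]
  simp [flat, h1, h2]

lemma mul_add_lt {d n i j : ℕ} (hi : i < d) (hj : j < n) : i * n + j < d * n := by
  calc i * n + j < i * n + n := by omega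
    _ = (i + 1) * n := by ring
    _ ≤ d * n := Nat.mul_le_mul_right _ hi

lemma div_lt {d n x : ℕ} (hx : x < d * n) : x / n < d := by
  rw [Nat.div_lt_iff_lt_mul]
  · exact hx
  · by_contra h
    simp [Nat.eq_zero_of_not_pos h] at hx

lemma pos_of_lt_mul {d n x : ℕ} (hx : x < d * n) : 0 < n := by
  by_contra h
  simp [Nat.eq_zero_of_not_pos h] at hx

lemma colRank_residueSeq {d : ℕ} (n m L : ℕ) (c : Fin d → Fin n → ℤ) :
    ResidueSeq n m L (colRank n m c) := fun x _ => ⟨-flat c x, by simp [colRank, rk]⟩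

/-- The change of coordinates behind the whole proof: as `i < d`, division of a generator by `d`
separates its rank from its row. -/
lemma aHat_sub {d n : ℕ} (m : ℕ) (c : Fin d → Fin n → ℤ) (i : Fin d) (j : Fin n) :
    aHat d n m i j - d * n * c i j = d * colRank n m c (i * n + j) + (i : ℕ) := by
  simp only [aHat, colRank, rk, flat_mul_add]
  push_cast
  ring

lemma mul_add_div_self {n i j : ℕ} (hj : j < n) : (i * n + j) / n = i := by
  rw [mul_comm, Nat.mul_add_div (by omega), Nat.div_eq_of_lt hj, add_zero]

lemma mul_add_mod_self {n i j : ℕ} (hj : j < n) : (i * n + j) % n = j := by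
  rw [mul_comm, Nat.mul_add_mod, Nat.mod_eq_of_lt hj]

lemma toSubset_eq_layerSet {d n : ℕ} (m : ℕ) (c : Fin d → Fin n → ℤ) :
    toSubset d n m c = layerSet d n (colRank n m c) := by
  ext a
  constructor
  · rintro ⟨i, j, k, h⟩
    refine ⟨i * n + j, mul_add_lt i.2 j.2, k, ?_⟩
    rw [aHat_sub] at h
    rw [h, mul_add_div_self j.2]
    ring
  · rintro ⟨x, hx, k, h⟩
    have hn := pos_of_lt_mul hx
    refine ⟨⟨x / n, div_lt hx⟩, ⟨x % n, Nat.mod_lt _ hn⟩, k, ?_⟩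
    rw [aHat_sub, h]
    have : x / n * n + x % n = x := by rw [mul_comm]; exact Nat.div_add_mod x n
    simp only [this]
    ring

section Coordinates

variable {d n m : ℕ} {q : ℕ → ℤ}

lemma exists_mul_residue (hn : 0 < n) (hco : Nat.Coprime n m) (B : ℤ) :
    ∃ j < n, (n : ℤ) ∣ B - m * j := by
  have h : IsCoprime (n : ℤ) m := Nat.isCoprime_iff_coprime.2 hco
  obtain ⟨a, b, hab⟩ := h
  have hn' : (0 : ℤ) < n := by exact_mod_cast hn
  refine ⟨((b * B) % n).toNat, ?_, ?_⟩
  · have h1 := Int.emod_nonneg (b * B) hn'.ne'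
    have h2 := Int.emod_lt_of_pos (b * B) hn'
    omega
  · rw [Int.toNat_of_nonneg (Int.emod_nonneg _ hn'.ne')]
    refine ⟨a * B + m * ((b * B) / n), ?_⟩
    have h3 := Int.emod_add_mul_ediv (b * B) n
    linear_combination (-B) * hab + (-(m : ℤ)) * h3

lemma residue_inj (hco : Nat.Coprime n m) {j j' : ℕ} (hj : j < n) (hj' : j' < n)
    (h : (n : ℤ) ∣ m * j - m * j') : j = j' := by
  have h : (n : ℤ) ∣ (j : ℤ) - j' := by
    rw [← mul_sub] at h
    exact (Nat.isCoprime_iff_coprime.2 hco).dvd_of_dvd_mul_left h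
  obtain ⟨t, ht⟩ := h
  have : |(j : ℤ) - j'| < n := by rw [abs_lt]; omega
  have := Int.eq_zero_of_abs_lt_dvd ⟨t, ht⟩ this
  omega

lemma ResidueSeq.congr_mod (hq : ResidueSeq n m (d * n) q) {x : ℕ}
    (hx : x < d * n) : (n : ℤ) ∣ q x - m * (x % n : ℕ) := by
  have h1 := hq x hx
  have h2 : (x : ℤ) = n * (x / n : ℕ) + (x % n : ℕ) := by exact_mod_cast (Nat.div_add_mod x n).symm
  rw [h2] at h1
  have : q x - m * (x % n : ℕ) = (q x - m * (n * (x / n : ℕ) + (x % n : ℕ))) +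
    n * (m * (x / n : ℕ)) := by ring
  rw [this]
  exact dvd_add h1 (dvd_mul_right _ _)

/-- The layer is `b % d`. Among the `n` columns of that layer, coprimality gives one whose rank is
congruent to `b / d` modulo `n`. -/
lemma ResidueSeq.exists_coord (hd : 0 < d) (hn : 0 < n) (hco : Nat.Coprime n m)
    (hq : ResidueSeq n m (d * n) q) (b : ℤ) :
    ∃ x < d * n, ∃ k : ℤ, b = d * (q x + n * k) + (x / n : ℕ) := by
  have hd' : (0 : ℤ) < d := by exact_mod_cast hd
  obtain ⟨j, hj, t, ht⟩ := exists_mul_residue hn hco (b / d)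
  have h1 := Int.emod_nonneg b hd'.ne'
  have h2 := Int.emod_lt_of_pos b hd'
  have hi : (b % d).toNat < d := by omega
  have hx := mul_add_lt hi hj
  obtain ⟨s, hs⟩ := hq.congr_mod hx
  rw [mul_add_mod_self hj] at hs
  refine ⟨_, hx, t - s, ?_⟩
  rw [mul_add_div_self hj, Int.toNat_of_nonneg h1]
  have h3 := Int.emod_add_mul_ediv b d
  linear_combination (-1 : ℤ) * h3 + d * ht - d * hs

/-- Reduction modulo `d` recovers the layer; after division by `d`, reduction modulo `n` recovers
the column inside it. -/
lemma ResidueSeq.coord_unique (hco : Nat.Coprime n m)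
    (hq : ResidueSeq n m (d * n) q) {x x' : ℕ} (hx : x < d * n) (hx' : x' < d * n) {k k' : ℤ}
    (h : d * (q x + n * k) + (x / n : ℕ) = d * (q x' + n * k') + (x' / n : ℕ)) :
    x = x' ∧ k = k' := by
  have hn := pos_of_lt_mul hx
  have h1 := div_lt hx
  have h2 := div_lt hx'
  have hdiv : x / n = x' / n := by
    have : (d : ℤ) ∣ ((x / n : ℕ) : ℤ) - (x' / n : ℕ) :=
      ⟨q x' + n * k' - (q x + n * k), by linear_combination h⟩
    generalize x / n = i at *
    generalize x' / n = i' at *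
    have := Int.eq_zero_of_abs_lt_dvd this (by rw [abs_lt]; omega)
    omega
  rw [hdiv] at h
  have hd' : (d : ℤ) ≠ 0 := by exact_mod_cast (Nat.zero_lt_of_lt h1).ne'
  have h3 : q x + n * k = q x' + n * k' := by
    have : (d : ℤ) * (q x + n * k) = d * (q x' + n * k') := by linarith
    exact mul_left_cancel₀ hd' this
  obtain ⟨s, hs⟩ := hq.congr_mod hx
  obtain ⟨s', hs'⟩ := hq.congr_mod hx'
  have hmod : x % n = x' % n := residue_inj hco (Nat.mod_lt _ hn) (Nat.mod_lt _ hn)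
    ⟨s' - s + k' - k, by linear_combination h3 - hs + hs'⟩
  have hxx : x = x' := by
    rw [← Nat.div_add_mod x n, ← Nat.div_add_mod x' n, hdiv, hmod]
  subst hxx
  have hn' : (n : ℤ) ≠ 0 := by omega
  exact ⟨rfl, mul_left_cancel₀ hn' (by linarith)⟩

lemma coord_mem_layerSet (hco : Nat.Coprime n m)
    (hq : ResidueSeq n m (d * n) q) {x : ℕ} (hx : x < d * n) {k : ℤ} {a : ℕ}
    (ha : (a : ℤ) = d * (q x + n * k) + (x / n : ℕ)) : a ∈ layerSet d n q ↔ 0 ≤ k := by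
  constructor
  · rintro ⟨x', hx', k', h⟩
    have := (hq.coord_unique hco hx hx' (ha ▸ h)).2
    omega
  · intro hk
    exact ⟨x, hx, k.toNat, by rw [ha, Int.toNat_of_nonneg hk]⟩

lemma layerGen_cast {x : ℕ} (h0 : 0 ≤ q x) :
    (layerGen d n q x : ℤ) = d * q x + (x / n : ℕ) :=
  Int.toNat_of_nonneg (by positivity)

lemma layerGen_injOn (hco : Nat.Coprime n m) (hq : ResidueSeq n m (d * n) q)
    (h0 : ∀ x < d * n, 0 ≤ q x) : InjOn (layerGen d n q) (Finset.range (d * n)) := by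
  intro x hx x' hx' h
  simp only [Finset.coe_range, mem_Iio] at hx hx'
  refine (hq.coord_unique (k := 0) (k' := 0) hco hx hx' ?_).1
  have := layerGen_cast (d := d) (n := n) (h0 x hx)
  have := layerGen_cast (d := d) (n := n) (h0 x' hx')
  rw [h] at *
  linarith

/-- Subtracting `dn` lowers the coordinate `k` by one, so the generators are the points with `k =
0`. Nonnegative ranks guarantee that these points are natural numbers, so that `toNat` in `layerGen`
truncates nothing. -/
lemma generators_layerSet (hco : Nat.Coprime n m) (hq : ResidueSeq n m (d * n) q)
    (h0 : ∀ x < d * n, 0 ≤ q x) :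
    generators (d * n) (layerSet d n q) = layerGen d n q '' (Finset.range (d * n)) := by
  ext a
  constructor
  · rintro ⟨⟨x, hx, k, hk⟩, hb⟩
    refine ⟨x, by simpa using hx, ?_⟩
    rcases k with _ | k
    · have := layerGen_cast (d := d) (n := n) (h0 x hx)
      have : (layerGen d n q x : ℤ) = a := by rw [hk, this]; simp
      exact_mod_cast this
    · exfalso
      have hpos : (0 : ℤ) ≤ d * (q x + n * k) + (x / n : ℕ) := by
        have := h0 x hx
        positivity
      refine hb ⟨(d * (q x + n * k) + (x / n : ℕ)).toNat, ⟨x, hx, k, Int.toNat_of_nonneg hpos⟩, ?_⟩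
      have : (a : ℤ) = (d * (q x + n * k) + (x / n : ℕ)).toNat + d * n := by
        rw [Int.toNat_of_nonneg hpos, hk]
        push_cast
        ring
      exact_mod_cast this
  · rintro ⟨x, hx, rfl⟩
    replace hx : x < d * n := by simpa using hx
    have hc := layerGen_cast (d := d) (n := n) (h0 x hx)
    refine ⟨⟨x, hx, 0, by rw [hc]; simp⟩, ?_⟩
    rintro ⟨b, ⟨x', hx', k, hb⟩, h⟩
    have h' : (layerGen d n q x : ℤ) = b + d * n := by exact_mod_cast h
    rw [hc, hb] at h'
    have := hq.coord_unique (k := 0) (k' := k + 1) hco hx hx' (by linear_combination h')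
    omega

end Coordinates

lemma toMatrix_toSubset {d n m : ℕ} (hco : Nat.Coprime n m) (c : Fin d → Fin n → ℤ)
    (h0 : ∀ x < d * n, 0 ≤ colRank n m c x) :
    toMatrix d n m (toSubset d n m c) = c := by
  funext i j
  have hx := mul_add_lt i.2 j.2
  have hn : 0 < n := pos_of_lt_mul hx
  have hdn : (d * n : ℤ) ≠ 0 := by
    have : 0 < d := i.pos
    positivity
  have hq := colRank_residueSeq n m (d * n) c
  -- The infimum in `toMatrix` is taken over a singleton, because each class modulo `dn` contains
  -- exactly one generator.
  have key : {a : ℕ | a ∈ generators (d * n) (toSubset d n m c) ∧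
      (a : ℤ) ≡ aHat d n m i j [ZMOD (d * n : ℤ)]} =
      {layerGen d n (colRank n m c) (i * n + j)} := by
    have hc := layerGen_cast (d := d) (n := n) (h0 _ hx)
    rw [mul_add_div_self j.2] at hc
    have ha := aHat_sub m c i j
    ext a
    rw [mem_ofPred_eq, mem_singleton_iff, toSubset_eq_layerSet, generators_layerSet hco hq h0]
    constructor
    · rintro ⟨⟨x, hx', rfl⟩, h⟩
      replace hx' : x < d * n := by simpa using hx'
      obtain ⟨t, ht⟩ := h.dvd
      rw [layerGen_cast (h0 _ hx')] at ht
      have := hq.coord_unique (k := t + - c i j) (k' := 0) hco hx' hx (by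
        rw [mul_add_div_self j.2]
        linear_combination ha - ht)
      rw [this.1]
    · rintro rfl
      refine ⟨⟨_, by simpa using hx, rfl⟩, ?_⟩
      refine Int.modEq_iff_dvd.2 ⟨c i j, ?_⟩
      rw [hc]
      linear_combination ha
  unfold toMatrix
  rw [key, csInf_singleton, layerGen_cast (h0 _ hx), mul_add_div_self j.2]
  have : aHat d n m i j - (d * colRank n m c (i * n + j) + (i : ℕ)) = (d * n) * c i j := by
    linear_combination aHat_sub m c i j
  rw [this, Int.mul_ediv_cancel_left _ hdn]

end

section

/-! ### Admissible subsets in terms of rank sequences -/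

/-- The block `q (u n), …, q (u n + n - 1)` generates an `m`-invariant set. -/
def CyclicBlock (n m : ℕ) (q : ℕ → ℤ) (u : ℕ) : Prop :=
  ∀ j < n, q (u * n + (j + 1) % n) ≤ q (u * n + j) + m

/-- The blocks `u` and `u + 1` are linked, as required by the admissibility of `u`. -/
def LinkedBlock (n m : ℕ) (q : ℕ → ℤ) (u : ℕ) : Prop :=
  ∃ j < n, q ((u + 1) * n + (j + 1) % n) ≤ q (u * n + j) + m

/-- The conditions on the rank sequence of an admissible `0`-normalized subset. -/
structure AdmissibleSeq (d n m : ℕ) (q : ℕ → ℤ) : Prop where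
  residue : ResidueSeq n m (d * n) q
  zero : q 0 = 0
  nonneg : ∀ x < d * n, 0 ≤ q x
  block : ∀ u < d, CyclicBlock n m q u
  linked : ∀ u, u + 1 < d → LinkedBlock n m q u

/-- Admissible subsets that contain `0` and are closed under adding `dn` and `dm`. -/
def IsInvariantAdmissible (d n m : ℕ) (Δ : Set ℕ) : Prop :=
  0 ∈ Δ ∧ (∀ b ∈ Δ, b + d * n ∈ Δ ∧ b + d * m ∈ Δ) ∧ IsAdmissible d n m Δ

variable {d n m : ℕ} {q : ℕ → ℤ}

lemma dvd_trans_eq {a b c : ℤ} (h : a ∣ b) (e : b = c) : a ∣ c := e ▸ h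

lemma dvd_mul_succ_mod (n m j : ℕ) : (n : ℤ) ∣ m * ((j + 1) % n : ℕ) - m * (j + 1) := by
  have h2 : ((j + 1 : ℕ) : ℤ) = n * ((j + 1) / n : ℕ) + ((j + 1) % n : ℕ) := by
    exact_mod_cast (Nat.div_add_mod (j + 1) n).symm
  push_cast at h2 ⊢
  exact ⟨-(m * ((j + 1) / n)), by linear_combination (-(m : ℤ)) * h2⟩

lemma ResidueSeq.dvd_succ (hq : ResidueSeq n m (d * n) q) {i i' j : ℕ} (hi : i < d) (hi' : i' < d)
    (hj : j < n) : (n : ℤ) ∣ q (i * n + j) + m - q (i' * n + (j + 1) % n) := by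
  have hj' : (j + 1) % n < n := Nat.mod_lt _ (by omega)
  have h1 := hq.congr_mod (mul_add_lt hi hj)
  have h2 := hq.congr_mod (mul_add_lt hi' hj')
  rw [mul_add_mod_self hj] at h1
  rw [mul_add_mod_self hj'] at h2
  have h3 := dvd_mul_succ_mod n m j
  have := dvd_sub (dvd_sub h1 h2) h3
  exact dvd_trans_eq (this) (by ring)

/-- The integer `a` lies in layer `i'` and in the residue class of column `j + 1`, so its membership
is a comparison with a single generator. The case `i' = i` expresses invariance under `dm`, the case
`i' = i + 1` admissibility. -/
lemma add_mem_layerSet_iff (hco : Nat.Coprime n m) (hq : ResidueSeq n m (d * n) q) {i i' j a : ℕ}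
    (hi : i < d) (hi' : i' < d) (hj : j < n) (ha : (a : ℤ) = d * (q (i * n + j) + m) + i') :
    a ∈ layerSet d n q ↔ q (i' * n + (j + 1) % n) ≤ q (i * n + j) + m := by
  have hj' : (j + 1) % n < n := Nat.mod_lt _ (by omega)
  obtain ⟨k, hk⟩ := hq.dvd_succ hi hi' hj
  have hn : (0 : ℤ) < n := by omega
  rw [coord_mem_layerSet (k := k) hco hq (mul_add_lt hi' hj')]
  · constructor
    · intro h
      have := mul_nonneg hn.le h
      linarith
    · intro h
      by_contra hc
      have := mul_neg_of_pos_of_neg hn (not_le.1 hc)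
      linarith
  · rw [mul_add_div_self hj', ha]
    linear_combination (d : ℤ) * hk

lemma div_mul_add_mod (n x : ℕ) : x / n * n + x % n = x := by
  rw [mul_comm]; exact Nat.div_add_mod x n

lemma AdmissibleSeq.isInvariantAdmissible (hd : 0 < d) (hn : 0 < n) (hco : Nat.Coprime n m)
    (hq : AdmissibleSeq d n m q) : IsInvariantAdmissible d n m (layerSet d n q) := by
  have h00 : 0 < d * n := by positivity
  refine ⟨⟨0, h00, 0, by simp [hq.zero]⟩, ?_, ?_⟩
  · rintro b ⟨x, hx, k, hb⟩
    refine ⟨⟨x, hx, k + 1, by rw [Nat.cast_add, hb]; push_cast; ring⟩, ?_⟩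
    have hxn := Nat.mod_lt x hn
    have hxd := div_lt hx
    have hj' : (x % n + 1) % n < n := Nat.mod_lt _ hn
    have h := hq.block _ hxd _ hxn
    obtain ⟨t, ht⟩ := hq.residue.dvd_succ hxd hxd hxn
    rw [div_mul_add_mod] at h ht
    rw [coord_mem_layerSet (k := k + t) hco hq.residue (mul_add_lt hxd hj')]
    · have hn' : (0 : ℤ) < n := by omega
      have : 0 ≤ t := by
        by_contra hc
        have := mul_neg_of_pos_of_neg hn' (not_le.1 hc)
        linarith
      positivity
    · rw [mul_add_div_self hj']
      push_cast at hb ⊢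
      linear_combination hb + d * ht
  · intro i hi
    have hgen := generators_layerSet hco hq.residue hq.nonneg
    have hmem : ∀ j < n, layerGen d n q (i * n + j) ∈ generators (d * n) (layerSet d n q) ∧
        layerGen d n q (i * n + j) ≡ i [MOD d] ∧
        (layerGen d n q (i * n + j) : ℤ) = d * q (i * n + j) + i := by
      intro j hj
      have hx := mul_add_lt hi hj
      have hc := layerGen_cast (d := d) (n := n) (hq.nonneg _ hx)
      rw [mul_add_div_self hj] at hc
      refine ⟨?_, ?_, hc⟩
      · rw [hgen]
        exact ⟨_, by simpa using hx, rfl⟩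
      · rw [← Int.natCast_modEq_iff, hc]
        exact Int.modEq_iff_dvd.2 ⟨-q (i * n + j), by ring⟩
    rcases Nat.lt_or_ge (i + 1) d with h | h
    · obtain ⟨j, hj, hle⟩ := hq.linked i h
      obtain ⟨h1, h2, h3⟩ := hmem j hj
      refine ⟨_, h1, h2, ?_⟩
      rw [add_mem_layerSet_iff hco hq.residue hi h hj]
      · exact hle
      · push_cast
        linear_combination h3
    -- In the last layer `a + dm + 1` wraps around to layer `0`. With `m j ≡ -m - 1` modulo `n` it
    -- is a multiple of `dn`, hence in the progression of the generator `0`; the last index is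
    -- admissible without any link.
    · obtain ⟨j, hj, t, ht⟩ := exists_mul_residue hn hco (-m - 1)
      obtain ⟨h1, h2, h3⟩ := hmem j hj
      refine ⟨_, h1, h2, ?_⟩
      obtain ⟨s, hs⟩ := hq.residue.congr_mod (mul_add_lt hi hj)
      rw [mul_add_mod_self hj] at hs
      rw [coord_mem_layerSet (k := s - t) hco hq.residue h00]
      · have h0 := hq.nonneg _ (mul_add_lt hi hj)
        by_contra hc
        have hn' : (0 : ℤ) < n := by omega
        have := mul_neg_of_pos_of_neg hn' (not_le.1 hc)
        have : (n : ℤ) * (s - t) = q (i * n + j) + m + 1 := by linear_combination ht - hs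
        omega
      · have hid : (i : ℤ) + 1 = d := by omega
        rw [hq.zero]
        rw [Nat.zero_div]
        push_cast
        linear_combination h3 + hid + d * hs - d * ht

lemma generator_le {N a b : ℕ} (hN : 0 < N) {Δ : Set ℕ} (hcl : ∀ b ∈ Δ, b + N ∈ Δ)
    (ha : a ∈ generators N Δ) (hb : b ∈ Δ) (hab : (N : ℤ) ∣ b - a) : a ≤ b := by
  by_contra hlt
  push Not at hlt
  obtain ⟨t, ht⟩ := hab
  have ht0 : t < 0 := by
    by_contra hc
    have := mul_nonneg (by positivity : (0 : ℤ) ≤ N) (not_lt.1 hc)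
    omega
  have hmul : ∀ k : ℕ, b + N * k ∈ Δ := by
    intro k
    induction k with
    | zero => simpa using hb
    | succ k ih => rw [mul_add, mul_one, ← add_assoc]; exact hcl _ ih
  obtain ⟨k, rfl⟩ : ∃ k : ℕ, t = -(k + 1) := ⟨(-t - 1).toNat, by omega⟩
  refine ha.2 ⟨_, hmul k, ?_⟩
  zify
  linear_combination -ht

lemma IsInvariantAdmissible.add_mem {Δ : Set ℕ} (hΔ : IsInvariantAdmissible d n m Δ) {b : ℕ}
    (hb : b ∈ Δ) (k l : ℕ) : b + k * (d * n) + l * (d * m) ∈ Δ := by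
  induction l with
  | zero =>
    induction k with
    | zero => simpa using hb
    | succ k ih =>
      have := (hΔ.2.1 _ ih).1
      convert this using 1
      ring
  | succ l ih =>
    have := (hΔ.2.1 _ ih).2
    convert this using 1
    ring

/-- `k` in `{0, …, n - 1}` with `b + k d m ≡ a (mod dn)`. -/
lemma exists_shift (hn : 0 < n) (hco : Nat.Coprime n m) {a b : ℤ} (hab : (d : ℤ) ∣ a - b) :
    ∃ t < n, ((d * n : ℕ) : ℤ) ∣ b + t * (d * m) - a := by
  obtain ⟨s, hs⟩ := hab
  obtain ⟨t, ht, k, hk⟩ := exists_mul_residue hn hco s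
  refine ⟨t, ht, -k, ?_⟩
  push_cast
  linear_combination -hs - d * hk

/-- Invariance under the third generator of the semigroup is free. If `a` witnesses admissibility
for the class of `b` modulo `d`, then `b + t dm = a + k dn` with `0 ≤ t < n` and `k ≥ 0`, hence `dmn
+ 1 + b = (a + dm + 1) + k dn + (n - 1 - t) dm`. -/
lemma IsInvariantAdmissible.add_genus_mem (hd : 0 < d) (hn : 0 < n) (hco : Nat.Coprime n m)
    {Δ : Set ℕ} (hΔ : IsInvariantAdmissible d n m Δ) {b : ℕ} (hb : b ∈ Δ) :
    d * m * n + 1 + b ∈ Δ := by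
  obtain ⟨a, ha, hai, ham⟩ := hΔ.2.2 (b % d) (Nat.mod_lt _ hd)
  have hab : (d : ℤ) ∣ (a : ℤ) - b := by
    have : a ≡ b [MOD d] := hai.trans (Nat.mod_modEq b d)
    exact (Nat.modEq_iff_dvd.1 this.symm)
  obtain ⟨t, ht, k, hk⟩ := exists_shift (m := m) hn hco hab
  have hle : a ≤ b + t * (d * m) := by
    refine generator_le (by positivity : 0 < d * n) (fun b hb => (hΔ.2.1 b hb).1) ha
      (by simpa using hΔ.add_mem hb 0 t) ⟨k, ?_⟩
    push_cast at hk ⊢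
    linear_combination hk
  have hk0 : 0 ≤ k := by
    by_contra hc
    have hN : (0 : ℤ) < (d * n : ℕ) := by positivity
    have := mul_neg_of_pos_of_neg hN (not_le.1 hc)
    zify at hle
    linarith
  obtain ⟨k, rfl⟩ := Int.eq_ofNat_of_zero_le hk0
  have := hΔ.add_mem ham k (n - 1 - t)
  convert this using 1
  zify
  rw [Nat.cast_sub (by omega), Nat.cast_sub (by omega)]
  push_cast at hk ⊢
  linear_combination hk

lemma mem_admissibleSubsets_iff (hd : 0 < d) (hn : 0 < n) (hco : Nat.Coprime n m) {Δ : Set ℕ} :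
    Δ ∈ admissibleSubsets d n m ↔ IsInvariantAdmissible d n m Δ := by
  constructor
  · rintro ⟨h0, hcl, had⟩
    refine ⟨h0, fun b hb => ⟨?_, ?_⟩, had⟩
    · rw [add_comm]
      exact hcl _ (AddSubmonoid.subset_closure (by simp)) b hb
    · rw [add_comm]
      exact hcl _ (AddSubmonoid.subset_closure (by simp)) b hb
  · intro hΔ
    refine ⟨hΔ.1, ?_, hΔ.2.2⟩
    intro g hg
    induction hg using AddSubmonoid.closure_induction with
    | mem x hx =>
      intro b hb
      rcases hx with rfl | rfl | rfl
      · rw [add_comm]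
        exact (hΔ.2.1 b hb).1
      · rw [add_comm]
        exact (hΔ.2.1 b hb).2
      · exact hΔ.add_genus_mem hd hn hco hb
    | zero => simp
    | add x y _ _ hx hy =>
      intro b hb
      rw [add_assoc]
      exact hx _ (hy b hb)

/-! ### The rank sequence of an admissible subset -/

lemma exists_mem_generators {N b : ℕ} {Δ : Set ℕ} (hN : 0 < N) (hb : b ∈ Δ) :
    ∃ a ∈ generators N Δ, (N : ℤ) ∣ a - b := by
  induction b using Nat.strong_induction_on with
  | _ b ih =>
    by_cases h : ∃ c ∈ Δ, b = c + N
    · obtain ⟨c, hc, rfl⟩ := h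
      obtain ⟨a, ha, hac⟩ := ih c (by omega) hc
      refine ⟨a, ha, ?_⟩
      have := dvd_sub hac (dvd_refl (N : ℤ))
      exact dvd_trans_eq (this) (by push_cast; ring)
    · exact ⟨b, ⟨hb, h⟩, by simp⟩

/-- The infimum defining the matrix is over a nonempty set: admissibility provides an element in
every class modulo `d`, and adding multiples of `dm` reaches from there every class modulo `dn`. -/
lemma IsInvariantAdmissible.toMatrix_spec (hd : 0 < d) (hn : 0 < n) (hco : Nat.Coprime n m)
    {Δ : Set ℕ} (hΔ : IsInvariantAdmissible d n m Δ) (i : Fin d) (j : Fin n) :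
    ∃ a ∈ generators (d * n) Δ,
      (a : ℤ) = d * colRank n m (toMatrix d n m Δ) (i * n + j) + (i : ℕ) := by
  have hne : {a : ℕ | a ∈ generators (d * n) Δ ∧
      (a : ℤ) ≡ aHat d n m i j [ZMOD (d * n : ℤ)]}.Nonempty := by
    obtain ⟨a, ha, hai, -⟩ := hΔ.2.2 i i.2
    have hai' : (d : ℤ) ∣ aHat d n m i j - a := by
      have h1 := Nat.modEq_iff_dvd.1 hai
      have h2 : (d : ℤ) ∣ aHat d n m i j - (i : ℕ) :=
        ⟨(j : ℕ) * m + m * n * (i : ℕ), by simp only [aHat]; ring⟩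
      exact dvd_trans_eq (dvd_add h1 h2) (by ring)
    obtain ⟨t, -, ht⟩ := exists_shift (m := m) hn hco hai'
    obtain ⟨a', ha', h⟩ := exists_mem_generators (N := d * n) (by positivity)
      (hΔ.add_mem ha.1 0 t)
    refine ⟨a', ha', (Int.modEq_iff_dvd.2 ?_).symm⟩
    have := dvd_add h ht
    push_cast at this ⊢
    exact dvd_trans_eq (this) (by ring)
  obtain ⟨hg, hmod⟩ := Nat.sInf_mem hne
  refine ⟨_, hg, ?_⟩
  obtain ⟨t, ht⟩ := hmod.dvd
  have hdn : (d * n : ℤ) ≠ 0 := by positivity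
  have hc : toMatrix d n m Δ i j = t := by
    unfold toMatrix
    rw [ht, Int.mul_ediv_cancel_left _ hdn]
  rw [← aHat_sub, hc]
  linear_combination -ht

lemma IsInvariantAdmissible.toMatrix_nonneg (hd : 0 < d) (hn : 0 < n) (hco : Nat.Coprime n m)
    {Δ : Set ℕ} (hΔ : IsInvariantAdmissible d n m Δ) :
    ∀ x < d * n, 0 ≤ colRank n m (toMatrix d n m Δ) x := by
  intro x hx
  obtain ⟨a, -, ha⟩ := hΔ.toMatrix_spec hd hn hco ⟨x / n, div_lt hx⟩ ⟨x % n, Nat.mod_lt _ hn⟩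
  have hlt : ((x / n : ℕ) : ℤ) < d := by exact_mod_cast div_lt hx
  simp only [div_mul_add_mod] at ha
  by_contra hc
  push Not at hc
  have : (d : ℤ) * colRank n m (toMatrix d n m Δ) x ≤ d * (-1) :=
    mul_le_mul_of_nonneg_left (by omega) (by positivity)
  generalize x / n = i at *
  omega

lemma IsInvariantAdmissible.layerSet_toMatrix (hd : 0 < d) (hn : 0 < n) (hco : Nat.Coprime n m)
    {Δ : Set ℕ} (hΔ : IsInvariantAdmissible d n m Δ) :
    layerSet d n (colRank n m (toMatrix d n m Δ)) = Δ := by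
  have hq := colRank_residueSeq n m (d * n) (toMatrix d n m Δ)
  ext b
  constructor
  · rintro ⟨x, hx, k, hb⟩
    obtain ⟨a, hag, ha⟩ := hΔ.toMatrix_spec hd hn hco ⟨x / n, div_lt hx⟩ ⟨x % n, Nat.mod_lt _ hn⟩
    simp only [div_mul_add_mod] at ha
    have := hΔ.add_mem hag.1 k 0
    convert this using 1
    zify at hb ha ⊢
    linear_combination hb - ha
  · intro hb
    obtain ⟨x, hx, k, hk⟩ := hq.exists_coord hd hn hco (b : ℤ)
    obtain ⟨a, hag, ha⟩ := hΔ.toMatrix_spec hd hn hco ⟨x / n, div_lt hx⟩ ⟨x % n, Nat.mod_lt _ hn⟩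
    simp only [div_mul_add_mod] at ha
    rw [coord_mem_layerSet hco hq hx hk]
    have hle : a ≤ b := by
      refine generator_le (by positivity : 0 < d * n) (fun b hb => (hΔ.2.1 b hb).1) hag hb ⟨k, ?_⟩
      push_cast
      linear_combination hk - ha
    by_contra hc
    have hN : (0 : ℤ) < (d * n : ℕ) := by positivity
    have := mul_neg_of_pos_of_neg hN (not_le.1 hc)
    zify at hle
    push_cast at this
    linarith

lemma IsInvariantAdmissible.admissibleSeq (hd : 0 < d) (hn : 0 < n) (hco : Nat.Coprime n m)
    {Δ : Set ℕ} (hΔ : IsInvariantAdmissible d n m Δ) :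
    AdmissibleSeq d n m (colRank n m (toMatrix d n m Δ)) := by
  have hq := colRank_residueSeq n m (d * n) (toMatrix d n m Δ)
  have h0 := hΔ.toMatrix_nonneg hd hn hco
  have hset := hΔ.layerSet_toMatrix hd hn hco
  have hgen := generators_layerSet hco hq h0
  set q := colRank n m (toMatrix d n m Δ)
  rw [hset] at hgen
  refine ⟨hq, ?_, h0, ?_, ?_⟩
  -- Writing `0` in coordinates makes all its nonnegative parts vanish, so its generator has rank
  -- `0` and layer `0`; the residue modulo `n` then forces the column `0`.
  · have := hΔ.1
    rw [← hset] at this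
    obtain ⟨x, hx, k, hk⟩ := this
    have hx0 := h0 x hx
    have hnk : (0 : ℤ) ≤ n * k := by positivity
    have hd' : (0 : ℤ) < d := by omega
    have h1 : 0 ≤ (d : ℤ) * (q x + n * k) := by positivity
    have h2 : (d : ℤ) * (q x + n * k) = 0 := by
      rw [Nat.cast_zero] at hk
      generalize x / n = i at *
      omega
    have h3 : q x + n * k = 0 := (mul_eq_zero.1 h2).resolve_left hd'.ne'
    have h4 : x / n = 0 := by
      rw [h2] at hk
      simp only [Nat.cast_zero, zero_add] at hk
      exact_mod_cast hk.symm
    have h5 : q x = 0 := by omega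
    have h6 := hq.congr_mod hx
    rw [h5] at h6
    have h7 := residue_inj (j := 0) (j' := x % n) hco hn (Nat.mod_lt _ hn) (by simpa using h6)
    have : x = 0 := by rw [← Nat.div_add_mod x n, h4, ← h7]; simp
    rw [← this, h5]
  · intro u hu j hj
    have hc := layerGen_cast (d := d) (n := n) (h0 _ (mul_add_lt hu hj))
    rw [mul_add_div_self hj] at hc
    rw [← add_mem_layerSet_iff (a := layerGen d n q (u * n + j) + d * m) hco hq hu hu hj
      (by push_cast; linear_combination hc), hset]
    refine (hΔ.2.1 _ ?_).2
    have : layerGen d n q (u * n + j) ∈ generators (d * n) Δ := by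
      rw [hgen]
      exact ⟨_, by simpa using mul_add_lt hu hj, rfl⟩
    exact this.1
  · intro u hu
    obtain ⟨a, ha, hau, ham⟩ := hΔ.2.2 u (by omega)
    rw [hgen] at ha
    obtain ⟨x, hx, rfl⟩ := ha
    replace hx : x < d * n := by simpa using hx
    have hxd := div_lt hx
    have hxn := Nat.mod_lt x hn
    have hc := layerGen_cast (d := d) (n := n) (h0 _ hx)
    have hxu : x / n = u := by
      have h1 := Nat.modEq_iff_dvd.1 hau
      rw [hc] at h1
      have h2 : (d : ℤ) ∣ (u : ℤ) - (x / n : ℕ) := by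
        have := dvd_add h1 (dvd_mul_right (d : ℤ) (q x))
        exact dvd_trans_eq (this) (by ring)
      generalize x / n = i at *
      have := Int.eq_zero_of_abs_lt_dvd h2 (by rw [abs_lt]; omega)
      omega
    refine ⟨x % n, hxn, ?_⟩
    have hxx := div_mul_add_mod n x
    rw [hxu] at hxx hc
    rw [← add_mem_layerSet_iff (a := layerGen d n q x + d * m + 1) hco hq (by omega : u < d) hu hxn,
      hset]
    · exact ham
    · rw [hxx]
      push_cast
      linear_combination hc

lemma layerSet_generators_image {c : Fin d → Fin n → ℤ} (hn : 0 < n) (hco : Nat.Coprime n m)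
    (h0 : ∀ x < d * n, 0 ≤ colRank n m c x) :
    (fun a : ℕ => (a : ℤ)) '' generators (d * n) (layerSet d n (colRank n m c)) =
      {b | ∃ (i : Fin d) (j : Fin n), b = aHat d n m i j - d * n * c i j} := by
  rw [generators_layerSet hco (colRank_residueSeq n m _ c) h0]
  ext b
  constructor
  · rintro ⟨_, ⟨x, hx, rfl⟩, rfl⟩
    replace hx : x < d * n := by simpa using hx
    refine ⟨⟨x / n, div_lt hx⟩, ⟨x % n, Nat.mod_lt _ hn⟩, ?_⟩
    rw [aHat_sub]
    simp only [div_mul_add_mod]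
    exact layerGen_cast (h0 x hx)
  · rintro ⟨i, j, rfl⟩
    have hx := mul_add_lt i.2 j.2
    refine ⟨_, ⟨i * n + j, by simpa using hx, rfl⟩, ?_⟩
    simp only
    rw [layerGen_cast (h0 _ hx), aHat_sub, mul_add_div_self j.2]

end

section

/-! ### Moving a block inside a sequence -/

/-- `r` arises from `q` by moving the block `q (u n), …, q (u n + n - 1)`, rotated so that the
residues of the indices modulo `n` are kept, to the positions `p, …, p + n - 1`. -/
structure Glue (n u p : ℕ) (q r : ℕ → ℤ) : Prop where
  le : p ≤ u * n
  left : ∀ x < p, r x = q x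
  window : ∀ x, p ≤ x → x < p + n → r x = q (u * n + x % n)
  right : ∀ x, p ≤ x → x < u * n → r (x + n) = q x
  above : ∀ x, (u + 1) * n ≤ x → r x = q x

/-- The sequence `q` with its indices permuted by `s_{j,u} ∘ ⋯ ∘ s_{j,1}` in each residue class. -/
noncomputable def tower (n : ℕ) (p : ℕ → ℕ) (q : ℕ → ℤ) (u x : ℕ) : ℤ :=
  q ((permComp n p (x % n) u)⁻¹ (x / n) * n + x % n)

variable {d n m : ℕ} {p : ℕ → ℕ} {q r : ℕ → ℤ}

lemma tower_zero (n : ℕ) (p : ℕ → ℕ) (q : ℕ → ℤ) : tower n p q 0 = q := by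
  funext x
  simp [tower, permComp, div_mul_add_mod]

lemma permIndex_spec {u j : ℕ} (hp : p u ≤ u * n) :
    permIndex n p j u ≤ u ∧ p u ≤ permIndex n p j u * n + j :=
  Nat.sInf_mem (s := {i | i ≤ u ∧ p u ≤ i * n + j}) ⟨u, le_refl u, by omega⟩

lemma permIndex_le {u j i : ℕ} (hi : i ≤ u) (h : p u ≤ i * n + j) : permIndex n p j u ≤ i :=
  Nat.sInf_le (s := {i | i ≤ u ∧ p u ≤ i * n + j}) ⟨hi, h⟩

lemma permIndex_le_iff {u j i : ℕ} (hp : p u ≤ u * n) (hi : i ≤ u) :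
    permIndex n p j u ≤ i ↔ p u ≤ i * n + j := by
  refine ⟨fun h => ?_, permIndex_le hi⟩
  have := (permIndex_spec (j := j) hp).2
  have := Nat.mul_le_mul_right n h
  omega

lemma cyc_inv_apply (i u a : ℕ) : (cyc i u)⁻¹ a =
    if i < a ∧ a ≤ u then a - 1 else if a = i ∧ i ≤ u then u else a := rfl

lemma tower_succ (u x : ℕ) : tower n p q (u + 1) x = tower n p q u
    ((cyc (permIndex n p (x % n) (u + 1)) (u + 1))⁻¹ (x / n) * n + x % n) := by
  rcases Nat.eq_zero_or_pos n with rfl | hn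
  · simp [tower]
  · have h := Nat.mod_lt x hn
    simp only [tower, permComp, mul_inv_rev, Equiv.Perm.mul_apply, mul_add_div_self h,
      mul_add_mod_self h]

/-- In column class `j`, a row `i ≤ u + 1` is at or above the permutation index exactly when `i n +
j ≥ p (u + 1)`. The positions `p, …, p + n - 1` meet each class once, precisely at its permutation
index. There the inverse cycle yields the row `u + 1`; it fixes the rows before and lowers those
after by one, a shift of `n` positions. -/
lemma glue_tower (hn : 0 < n) {u : ℕ} (hp : p (u + 1) ≤ (u + 1) * n) :
    Glue n (u + 1) (p (u + 1)) (tower n p q u) (tower n p q (u + 1)) := by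
  have key : ∀ x, x / n ≤ u + 1 →
      (permIndex n p (x % n) (u + 1) ≤ x / n ↔ p (u + 1) ≤ x) := by
    intro x hx
    rw [permIndex_le_iff hp hx, div_mul_add_mod]
  have hspec := fun j => (permIndex_spec (j := j) hp).1
  refine ⟨hp, ?_, ?_, ?_, ?_⟩
  · intro x hx
    have h1 : x / n ≤ u + 1 := by
      rw [← Nat.lt_succ_iff, Nat.div_lt_iff_lt_mul hn]
      have : (u + 1) * n ≤ (u + 1).succ * n := Nat.mul_le_mul_right _ (by omega)
      omega
    have h2 := key x h1
    rw [tower_succ, cyc_inv_apply, if_neg (by omega), if_neg (by omega), div_mul_add_mod]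
  · intro x hx hx'
    have h1 : x / n ≤ u + 1 := by
      rw [← Nat.lt_succ_iff, Nat.div_lt_iff_lt_mul hn, Nat.succ_mul]
      omega
    have h2 := key x h1
    -- A smaller permutation index would give `p (u + 1) ≤ x - n`, against `x < p (u + 1) + n`.
    have h3 : ¬ permIndex n p (x % n) (u + 1) < x / n := by
      intro h
      have h4 : permIndex n p (x % n) (u + 1) ≤ x / n - 1 := by omega
      rw [permIndex_le_iff hp (by omega), Nat.sub_mul] at h4
      have := div_mul_add_mod n x
      have : 1 * n ≤ x / n * n := Nat.mul_le_mul_right _ (by omega)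
      omega
    rw [tower_succ, cyc_inv_apply, if_neg (by omega), if_pos ⟨by omega, hspec _⟩]
  · intro x hx hx'
    have h1 : x / n < u + 1 := by rwa [Nat.div_lt_iff_lt_mul hn]
    have h2 := key x (by omega)
    rw [tower_succ, cyc_inv_apply, Nat.add_mod_right, Nat.add_div_right _ hn,
      if_pos (by omega), Nat.succ_sub_one, div_mul_add_mod]
  · intro x hx
    have h1 : u + 1 + 1 ≤ x / n := by rwa [Nat.le_div_iff_mul_le hn]
    have := hspec (x % n)
    rw [tower_succ, cyc_inv_apply, if_neg (by omega), if_neg (by omega), div_mul_add_mod]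

/-- `r (x + 1) ≤ r x + m` for consecutive indices below `L`. -/
def StepPath (m L : ℕ) (r : ℕ → ℤ) : Prop := ∀ x, x + 1 < L → r (x + 1) ≤ r x + m

/-! ### Inserting and deleting one cyclic block -/

section Step

variable {u P : ℕ}

lemma mod_succ_mod (n x : ℕ) : (x % n + 1) % n = (x + 1) % n := by simp

lemma CyclicBlock.succ_le (hn : 0 < n) (hb : CyclicBlock n m q u) (x : ℕ) :
    q (u * n + (x + 1) % n) ≤ q (u * n + x % n) + m := by
  have := hb (x % n) (Nat.mod_lt _ hn)
  rwa [mod_succ_mod] at this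

/-- Entries after the insertion point are smaller than the inserted ones in the same class. -/
lemma lt_of_tilde_max (hn : 0 < n) (hb : CyclicBlock n m q u)
    (hP : IsGreatest (tildeMoveSet n m q u) P) {x : ℕ} (hx : P ≤ x) (hxu : x < u * n) :
    q x + m < q (u * n + (x + 1) % n) ∧ q x < q (u * n + x % n) := by
  have h1 : q x + m < q (u * n + (x + 1) % n) := by
    by_contra hc
    push Not at hc
    have : x + 1 ∈ tildeMoveSet n m q u := by
      refine ⟨x / n, x % n, ?_, Nat.mod_lt _ hn, ?_, ?_⟩
      · rwa [Nat.div_lt_iff_lt_mul hn]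
      · rw [div_mul_add_mod]
      · rw [div_mul_add_mod, mod_succ_mod]
        exact hc
    have := hP.2 this
    omega
  have := hb.succ_le hn x
  exact ⟨h1, by omega⟩

lemma tildeMoveSet_le {x : ℕ} (hx : x ∈ tildeMoveSet n m q u) :
    ∃ y, x = y + 1 ∧ y < u * n ∧ q (u * n + x % n) ≤ q y + m := by
  obtain ⟨i, j, hi, hj, rfl, h⟩ := hx
  refine ⟨i * n + j, rfl, mul_add_lt hi hj, ?_⟩
  rwa [← mod_succ_mod n (i * n + j), mul_add_mod_self hj]

/-- Inserting a cyclic block at the maximal possible place keeps the path condition. -/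
lemma Glue.stepPath (hn : 0 < n) (hg : Glue n u P q r) (hq : StepPath m (u * n) q)
    (hb : CyclicBlock n m q u) (hP : IsGreatest (tildeMoveSet n m q u) P) :
    StepPath m ((u + 1) * n) r := by
  have hle := hg.le
  obtain ⟨y, hy, hyu, hyP⟩ := tildeMoveSet_le hP.1
  intro x hx
  rw [Nat.succ_mul] at hx
  rcases lt_or_ge (x + 1) P with h | h
  · rw [hg.left _ h, hg.left _ (by omega)]
    exact hq x (by omega)
  rcases lt_or_ge x P with h1 | h1
  · have hxy : x = y := by omega
    rw [hg.left _ h1, hg.window _ h (by omega), hxy, ← hy]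
    exact hyP
  rcases lt_or_ge (x + 1) (P + n) with h2 | h2
  · rw [hg.window _ h h2, hg.window _ h1 (by omega)]
    exact hb.succ_le hn x
  obtain ⟨z, hz⟩ : ∃ z, x + 1 = z + n := ⟨x + 1 - n, by omega⟩
  rcases lt_or_ge x (P + n) with h3 | h3
  -- At the right end of the window the path continues with an entry smaller than the block entry of
  -- the same class, and cyclicity already allows a step to the latter.
  · rw [hz, hg.right z (by omega) (by omega), hg.window _ h1 h3]
    have h4 := (lt_of_tilde_max hn hb hP (x := z) (by omega) (by omega)).2
    have h5 := hb.succ_le hn x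
    rw [hz, Nat.add_mod_right] at h5
    omega
  · obtain ⟨z', rfl⟩ : ∃ z', z = z' + 1 := ⟨z - 1, by omega⟩
    have hx' : x = z' + n := by omega
    rw [hz, hg.right _ (by omega) (by omega), hx', hg.right _ (by omega) (by omega)]
    exact hq _ (by omega)

/-- The place of insertion is the move index of the longer sequence. -/
lemma Glue.isGreatest_moveSet (hn : 0 < n) (hg : Glue n u P q r)
    (hb : CyclicBlock n m q u) (hP : IsGreatest (tildeMoveSet n m q u) P)
    (hlt : ∀ x, P ≤ x → x + n ≤ u * n → q (x + n - 1) + m < q x) :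
    IsGreatest (moveSet n m r u) P := by
  have hle := hg.le
  refine ⟨⟨hle, ?_⟩, ?_⟩
  · rw [hg.window P le_rfl (by omega), hg.window (P + n - 1) (by omega) (by omega)]
    have := hb.succ_le hn (P + n - 1)
    rwa [show P + n - 1 + 1 = P + n by omega, Nat.add_mod_right] at this
  · rintro x ⟨hxu, hx⟩
    by_contra hc
    push Not at hc
    obtain ⟨z, rfl⟩ : ∃ z, x = z + 1 := ⟨x - 1, by omega⟩
    have h1 := (lt_of_tilde_max hn hb hP (x := z) (by omega) (by omega)).1
    rw [show z + 1 + n - 1 = z + n by omega, hg.right z (by omega) (by omega)] at hx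
    -- A later window that starts inside the inserted block would end at an entry from which `q`
    -- could have been followed by the block, against the maximality of `P`. One that starts behind
    -- the block is a window of `q`, excluded by `hlt`.
    rcases lt_or_ge (z + 1) (P + n) with h2 | h2
    · rw [hg.window _ (by omega) h2] at hx
      omega
    · obtain ⟨w, hw⟩ : ∃ w, z + 1 = w + n := ⟨z + 1 - n, by omega⟩
      rw [hw, hg.right w (by omega) (by omega)] at hx
      have := hlt w (by omega) (by omega)
      rw [← hw, Nat.add_sub_cancel] at this
      omega

lemma moveSet_max_lt (hP : IsGreatest (moveSet n m r u) P) {x : ℕ} (hx : P < x) (hxu : x ≤ u * n) :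
    r (x + n - 1) + m < r x := by
  by_contra hc
  push Not at hc
  have := hP.2 (show x ∈ moveSet n m r u from ⟨hxu, hc⟩)
  omega

/-- The position `0` always qualifies, since the path starts at `0` and stays nonnegative. -/
lemma moveSet_exists_isGreatest (hn : 0 < n) (hu : 0 < u) (h0 : r 0 = 0)
    (hr : ∀ x < (u + 1) * n, 0 ≤ r x) : IsGreatest (moveSet n m r u) (sSup (moveSet n m r u)) := by
  have hne : (moveSet n m r u).Nonempty := by
    refine ⟨0, Nat.zero_le _, ?_⟩
    have := hr (0 + n - 1) (by
      have : 1 * n ≤ (u + 1) * n := Nat.mul_le_mul_right _ (by omega)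
      omega)
    rw [h0]
    positivity
  have hbd : BddAbove (moveSet n m r u) := ⟨u * n, fun x hx => hx.1⟩
  exact ⟨Nat.sSup_mem hne hbd, fun x hx => le_csSup hbd hx⟩

/-- If the maximum were `0`, the window at `1` would not close, so `r n + m < r 1 ≤ m` and `r n`
would be negative. -/
lemma moveSet_max_pos (hn : 0 < n) (hu : 0 < u) (h0 : r 0 = 0)
    (hr : ∀ x < (u + 1) * n, 0 ≤ r x) (hs : StepPath m ((u + 1) * n) r)
    (hP : IsGreatest (moveSet n m r u) P) : 0 < P := by
  by_contra hc
  have h1 : 1 * n ≤ u * n := Nat.mul_le_mul_right _ hu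
  rw [Nat.succ_mul] at hr hs
  have h2 := moveSet_max_lt hP (x := 1) (by omega) (by omega)
  have h3 := hr (1 + n - 1) (by omega)
  have h4 := hs 0 (by omega)
  rw [h0] at h4
  rw [zero_add] at h4
  omega

/-- Entries at the distance `n` decrease behind the move index. -/
lemma moveSet_add_lt (hs : StepPath m ((u + 1) * n) r) (hP : IsGreatest (moveSet n m r u) P) {x : ℕ}
    (hx : P ≤ x) (hxu : x < u * n) : r (x + n) < r x := by
  rw [StepPath, Nat.succ_mul] at hs
  have h1 := moveSet_max_lt hP (x := x + 1) (by omega) (by omega)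
  rw [show x + 1 + n - 1 = x + n by omega] at h1
  have h2 := hs x (by
    rcases Nat.eq_zero_or_pos n with rfl | hn
    · simp at hxu
    · omega)
  omega

/-- Deleting the window at the move index keeps the path condition. -/
lemma Glue.stepPath_of_moveSet (hn : 0 < n) (hg : Glue n u P q r)
    (hs : StepPath m ((u + 1) * n) r) (hP : IsGreatest (moveSet n m r u) P) :
    StepPath m (u * n) q := by
  intro x hx
  have hs' := hs
  rw [StepPath, Nat.succ_mul] at hs'
  rcases lt_or_ge (x + 1) P with h | h
  · rw [← hg.left _ h, ← hg.left _ (by omega)]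
    exact hs' x (by omega)
  rcases lt_or_ge x P with h1 | h1
  · rw [← hg.left _ h1, ← hg.right _ h (by omega)]
    have h2 := moveSet_add_lt hs hP h hx
    have h3 := hs' x (by omega)
    omega
  · rw [← hg.right _ h (by omega), ← hg.right _ h1 (by omega), show x + 1 + n = x + n + 1 by omega]
    exact hs' _ (by omega)

lemma mod_shift {n P j : ℕ} (hn : 0 < n) (hj : j < n) : ∃ x, P ≤ x ∧ x < P + n ∧ x % n = j := by
  have h := Nat.mod_lt P hn
  have hP := div_mul_add_mod n P
  rcases lt_or_ge j (P % n) with h1 | h1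
  · refine ⟨(P / n + 1) * n + j, ?_, ?_, mul_add_mod_self hj⟩ <;> rw [Nat.succ_mul] <;> omega
  · exact ⟨P / n * n + j, by omega, by omega, mul_add_mod_self hj⟩

/-- The deleted window is a cyclic block. -/
lemma Glue.cyclicBlock (hn : 0 < n) (hg : Glue n u P q r)
    (hs : StepPath m ((u + 1) * n) r) (hP : IsGreatest (moveSet n m r u) P) :
    CyclicBlock n m q u := by
  have hle := hg.le
  rw [StepPath, Nat.succ_mul] at hs
  intro j hj
  obtain ⟨x, h1, h2, rfl⟩ := mod_shift (P := P) hn hj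
  rw [mod_succ_mod, ← hg.window x h1 h2]
  rcases lt_or_ge (x + 1) (P + n) with h3 | h3
  · rw [← hg.window _ (by omega) h3]
    exact hs x (by omega)
  · have hx : x = P + n - 1 := by omega
    rw [show x + 1 = P + n by omega, Nat.add_mod_right, ← hg.window P le_rfl (by omega), hx]
    exact hP.1.2

/-- The move index of a path is the place where the deleted block has to be inserted. -/
lemma Glue.isGreatest_tildeMoveSet (hn : 0 < n) (hg : Glue n u P q r) (hP0 : 0 < P)
    (hs : StepPath m ((u + 1) * n) r) (hP : IsGreatest (moveSet n m r u) P) :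
    IsGreatest (tildeMoveSet n m q u) P := by
  have hle := hg.le
  have hs' := hs
  rw [StepPath, Nat.succ_mul] at hs'
  -- Going back in steps of `n`, the entries grow until the window is reached, so the block entry of
  -- a class dominates all entries of that class behind `P`.
  have chain : ∀ z, P ≤ z → z < (u + 1) * n → r z ≤ q (u * n + z % n) := by
    intro z
    induction z using Nat.strong_induction_on with
    | _ z ih =>
      intro h1 h2
      rw [Nat.succ_mul] at h2
      rcases lt_or_ge z (P + n) with h3 | h3
      · exact (hg.window z h1 h3).le
      · obtain ⟨w, rfl⟩ : ∃ w, z = w + n := ⟨z - n, by omega⟩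
        have := ih w (by omega) (by omega) (by rw [Nat.succ_mul]; omega)
        have := moveSet_add_lt hs hP (x := w) (by omega) (by omega)
        rw [Nat.add_mod_right]
        omega
  constructor
  · obtain ⟨x, rfl⟩ : ∃ x, P = x + 1 := ⟨P - 1, by omega⟩
    refine ⟨x / n, x % n, ?_, Nat.mod_lt _ hn, by rw [div_mul_add_mod], ?_⟩
    · rw [Nat.div_lt_iff_lt_mul hn]
      omega
    · rw [div_mul_add_mod, mod_succ_mod, ← hg.window _ le_rfl (by omega), ← hg.left x (by omega)]
      exact hs' x (by omega)
  · intro x hx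
    obtain ⟨y, rfl, hyu, h⟩ := tildeMoveSet_le hx
    by_contra hc
    push Not at hc
    have h1 := chain (y + 1) (by omega) (by rw [Nat.succ_mul]; omega)
    have h2 := moveSet_max_lt hP hc (by omega)
    rw [show y + 1 + n - 1 = y + n by omega, hg.right y (by omega) hyu] at h2
    omega

end Step

/-! ### Layered paths -/

/-- A family of sequences `V 0, …, V (d - 1)` that leads from the rank sequence of an admissible
subset to the rank sequence of a Dyck path, with move indices `p`. -/
structure LayeredPath (d n m : ℕ) (p : ℕ → ℕ) (V : ℕ → ℕ → ℤ) : Prop where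
  glue : ∀ u, u + 1 < d → Glue n (u + 1) (p (u + 1)) (V u) (V (u + 1))
  zero : ∀ u < d, V u 0 = 0
  nonneg : ∀ u < d, ∀ x < d * n, 0 ≤ V u x
  step : ∀ u < d, StepPath m ((u + 1) * n) (V u)
  block : ∀ u < d, CyclicBlock n m (V 0) u
  move : ∀ u, u + 1 < d → IsGreatest (moveSet n m (V (u + 1)) (u + 1)) (p (u + 1))
  tilde : ∀ u, u + 1 < d → IsGreatest (tildeMoveSet n m (V u) (u + 1)) (p (u + 1))
  pos : ∀ u, u + 1 < d → 0 < p (u + 1)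
  lt : ∀ u, u + 1 + 1 < d → p (u + 1) < p (u + 1 + 1)

variable {V : ℕ → ℕ → ℤ}

lemma eq_of_glue (hg : ∀ u, u + 1 < d → Glue n (u + 1) (p (u + 1)) (V u) (V (u + 1))) {u x : ℕ}
    (hu : u < d) (hx : (u + 1) * n ≤ x) : V u x = V 0 x := by
  induction u with
  | zero => rfl
  | succ u ih =>
    rw [(hg u hu).above x hx, ih (by omega)]
    have : (u + 1) * n ≤ (u + 1 + 1) * n := Nat.mul_le_mul_right _ (by omega)
    omega

lemma cyclicBlock_congr {u : ℕ}
    {q q' : ℕ → ℤ} (hn : 0 < n) (h : ∀ j < n, q (u * n + j) = q' (u * n + j))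
    (hb : CyclicBlock n m q u) : CyclicBlock n m q' u := by
  intro j hj
  rw [← h _ hj, ← h _ (Nat.mod_lt _ hn)]
  exact hb j hj

/-- Descending induction on the stage: each deletion leaves a nonnegative path starting at `0`, so
the next move index exists and is positive. -/
lemma layeredPath_of_path (hn : 0 < n) (hd : 0 < d)
    (hg : ∀ u, u + 1 < d → Glue n (u + 1) (p (u + 1)) (V u) (V (u + 1)))
    (h0 : V (d - 1) 0 = 0) (hnn : ∀ u < d, ∀ x < d * n, 0 ≤ V u x)
    (hs : StepPath m (d * n) (V (d - 1)))
    (hp : ∀ u, u + 1 < d → p (u + 1) = sSup (moveSet n m (V (u + 1)) (u + 1))) :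
    LayeredPath d n m p V := by
  have key : ∀ k, k < d → V (d - 1 - k) 0 = 0 ∧ StepPath m ((d - 1 - k + 1) * n) (V (d - 1 - k)) := by
    intro k
    induction k with
    | zero =>
      intro _
      refine ⟨h0, ?_⟩
      rwa [Nat.sub_zero, Nat.sub_add_cancel hd]
    | succ k ih =>
      intro hk
      obtain ⟨h1, h2⟩ := ih (by omega)
      obtain ⟨u, hu⟩ : ∃ u, d - 1 - k = u + 1 := ⟨d - 1 - k - 1, by omega⟩
      rw [hu] at h1 h2
      rw [show d - 1 - (k + 1) = u by omega]
      have hle : (u + 1 + 1) * n ≤ d * n := Nat.mul_le_mul_right _ (by omega)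
      have hr : ∀ x < (u + 1 + 1) * n, 0 ≤ V (u + 1) x :=
        fun x hx => hnn _ (by omega) x (by omega)
      have hP := moveSet_exists_isGreatest (m := m) hn (u := u + 1) (by omega) h1 hr
      rw [← hp u (by omega)] at hP
      have hpos := moveSet_max_pos hn (by omega) h1 hr h2 hP
      have hgu := hg u (by omega)
      exact ⟨by rw [← hgu.left 0 hpos, h1], hgu.stepPath_of_moveSet hn h2 hP⟩
  have hzs : ∀ u < d, V u 0 = 0 ∧ StepPath m ((u + 1) * n) (V u) := by
    intro u hu
    have := key (d - 1 - u) (by omega)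
    rwa [show d - 1 - (d - 1 - u) = u by omega] at this
  have hr : ∀ u, u + 1 < d → ∀ x < (u + 1 + 1) * n, 0 ≤ V (u + 1) x := by
    intro u hu x hx
    have hle : (u + 1 + 1) * n ≤ d * n := Nat.mul_le_mul_right _ (by omega)
    exact hnn _ (by omega) x (by omega)
  have hmove : ∀ u, u + 1 < d → IsGreatest (moveSet n m (V (u + 1)) (u + 1)) (p (u + 1)) := by
    intro u hu
    have hP := moveSet_exists_isGreatest (m := m) hn (u := u + 1) (by omega) (hzs _ hu).1 (hr u hu)
    rwa [← hp u hu] at hP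
  have hpos : ∀ u, u + 1 < d → 0 < p (u + 1) := fun u hu =>
    moveSet_max_pos hn (by omega) (hzs _ hu).1 (hr u hu) (hzs _ hu).2 (hmove u hu)
  refine ⟨hg, fun u hu => (hzs u hu).1, hnn, fun u hu => (hzs u hu).2, ?_, hmove, ?_, hpos, ?_⟩
  · intro u hu
    rcases u with _ | u
    -- The block that remains at the end is not a deleted window; it is cyclic because it starts
    -- with `0` and its last entry is nonnegative.
    · intro j hj
      obtain ⟨hz, hst⟩ := hzs 0 hu
      have h1n : 1 * n ≤ d * n := Nat.mul_le_mul_right _ hd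
      rcases lt_or_ge (j + 1) n with h | h
      · rw [Nat.mod_eq_of_lt h]
        simpa using hst j (by omega)
      · have : j + 1 = n := by omega
        rw [this, Nat.mod_self]
        have := hnn 0 hu (0 * n + j) (by omega)
        simp only [zero_mul, zero_add] at this ⊢
        rw [hz]
        positivity
    · refine cyclicBlock_congr hn (fun j _ => ?_)
        ((hg u hu).cyclicBlock hn (hzs _ hu).2 (hmove u hu))
      exact eq_of_glue hg (by omega) (by omega)
  · intro u hu
    exact (hg u hu).isGreatest_tildeMoveSet hn (hpos u hu) (hzs _ hu).2 (hmove u hu)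
  · intro u hu
    -- If the move indices did not grow, the window closing at `p (u + 1)` would reappear `n` places
    -- further right in the longer sequence, behind its last closing window.
    by_contra hc
    push Not at hc
    have hgu := hg (u + 1) (by omega)
    have hm := hmove u (by omega)
    have h1 := hm.1.1
    have h2 := hm.1.2
    have hle := hgu.le
    rw [← hgu.right _ hc (by rw [Nat.succ_mul]; omega),
      ← hgu.right (p (u + 1) + n - 1) (by omega) (by rw [Nat.succ_mul]; omega)] at h2
    have := moveSet_max_lt (hmove (u + 1) (by omega)) (x := p (u + 1) + n) (by omega)
      (by rw [Nat.succ_mul (u + 1)]; omega)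
    rw [show p (u + 1) + n - 1 + n = p (u + 1) + n + n - 1 by omega] at h2
    omega

/-- The entry of block `u` that links it to block `u + 1` sits, for `u ≥ 1`, in the window starting
at `p u`. It provides a place for block `u + 1` behind that start, so the insertion index exists and
exceeds `p u`. -/
lemma layeredPath_of_admissible (hn : 0 < n)
    (hg : ∀ u, u + 1 < d → Glue n (u + 1) (p (u + 1)) (V u) (V (u + 1)))
    (hnn : ∀ u < d, ∀ x < d * n, 0 ≤ V u x) (hq : AdmissibleSeq d n m (V 0))
    (hp : ∀ u, u + 1 < d → p (u + 1) = sSup (tildeMoveSet n m (V u) (u + 1))) :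
    LayeredPath d n m p V := by
  have hblock : ∀ u, u + 1 < d → CyclicBlock n m (V u) (u + 1) := fun u hu =>
    cyclicBlock_congr hn (fun j _ => (eq_of_glue hg (by omega) (by omega)).symm)
      (hq.block (u + 1) hu)
  have hins : ∀ u, u + 1 < d → ∀ x, x < (u + 1) * n →
      V u ((u + 1) * n + (x + 1) % n) ≤ V u x + m →
      IsGreatest (tildeMoveSet n m (V u) (u + 1)) (p (u + 1)) ∧ x < p (u + 1) := by
    intro u hu x hx h
    have hbd : BddAbove (tildeMoveSet n m (V u) (u + 1)) := ⟨(u + 1) * n, fun z hz => by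
      obtain ⟨y, rfl, hy, -⟩ := tildeMoveSet_le hz
      omega⟩
    have hx : x + 1 ∈ tildeMoveSet n m (V u) (u + 1) := by
      refine ⟨x / n, x % n, ?_, Nat.mod_lt _ hn, by rw [div_mul_add_mod], ?_⟩
      · rwa [Nat.div_lt_iff_lt_mul hn]
      · rwa [div_mul_add_mod, mod_succ_mod]
    rw [hp u hu]
    exact ⟨⟨Nat.sSup_mem ⟨_, hx⟩ hbd, fun z hz => le_csSup hbd hz⟩, le_csSup hbd hx⟩
  have hpp : ∀ u, u + 1 < d → IsGreatest (tildeMoveSet n m (V u) (u + 1)) (p (u + 1)) ∧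
      0 < p (u + 1) ∧ ∀ w, u = w + 1 → p u < p (u + 1) := by
    intro u hu
    obtain ⟨j, hj, h⟩ := hq.linked u hu
    have habove : V u ((u + 1) * n + (j + 1) % n) = V 0 ((u + 1) * n + (j + 1) % n) :=
      eq_of_glue hg (by omega) (by omega)
    rcases u with _ | w
    · have := hins 0 hu j (by omega) (by simpa using h)
      exact ⟨this.1, by omega, by omega⟩
    · have hgw := hg w (by omega)
      have hle := hgw.le
      obtain ⟨x, h1, h2, hxj⟩ := mod_shift (P := p (w + 1)) hn hj
      have := hins (w + 1) hu x (by rw [Nat.succ_mul (w + 1)]; omega) (by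
        rw [hgw.window x h1 h2, ← mod_succ_mod, hxj, habove,
          eq_of_glue hg (by omega : w < d) (by omega)]
        exact h)
      refine ⟨this.1, by omega, fun w' hw' => ?_⟩
      omega
  have hstep : ∀ u < d, StepPath m ((u + 1) * n) (V u) := by
    intro u hu
    induction u with
    | zero =>
      intro x hx
      rw [zero_add, one_mul] at hx
      have := hq.block 0 hu x (by omega)
      rw [Nat.mod_eq_of_lt hx] at this
      simpa using this
    | succ u ih => exact (hg u hu).stepPath hn (ih (by omega)) (hblock u hu) (hpp u hu).1
  refine ⟨hg, ?_, hnn, hstep, hq.block, ?_, fun u hu => (hpp u hu).1, fun u hu => (hpp u hu).2.1,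
    fun u hu => (hpp (u + 1) hu).2.2 u rfl⟩
  · intro u hu
    induction u with
    | zero => exact hq.zero
    | succ u ih => rw [(hg u hu).left 0 (hpp u hu).2.1, ih (by omega)]
  · intro u hu
    induction u with
    | zero =>
      refine (hg 0 hu).isGreatest_moveSet hn (hblock 0 hu) (hpp 0 hu).1 ?_
      intro x hx hxn
      have := (hpp 0 hu).2.1
      omega
    | succ u ih =>
      refine (hg (u + 1) hu).isGreatest_moveSet hn (hblock _ hu) (hpp _ hu).1 ?_
      intro x hx hxn
      -- The shorter sequence has no closing window at or behind the new index, because its last one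
      -- starts at the smaller index `p (u + 1)`.
      have := (hpp (u + 1) hu).2.2 u rfl
      refine moveSet_max_lt (ih (by omega)) (by omega) ?_
      rw [Nat.succ_mul (u + 1)] at hxn
      omega

/-- The new block follows some entry `y` with `y ≥ p u`, by the growth of the indices. Either `y`
lies in the window of block `u`, or it is smaller than the entry of that block in its class; in both
cases the block entry provides the link. For `u = 0` every earlier entry belongs to block `0`. -/
lemma LayeredPath.linkedBlock (hn : 0 < n) (hV : LayeredPath d n m p V) {u : ℕ} (hu : u + 1 < d) :
    LinkedBlock n m (V 0) u := by
  have habove : ∀ j, V u ((u + 1) * n + j) = V 0 ((u + 1) * n + j) := fun j =>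
    eq_of_glue hV.glue (by omega) (by omega)
  obtain ⟨y, hy, hyu, hyP⟩ := tildeMoveSet_le (hV.tilde u hu).1
  rw [hy, habove] at hyP
  refine ⟨y % n, Nat.mod_lt _ hn, ?_⟩
  rw [mod_succ_mod]
  rcases u with _ | w
  · rw [zero_add, one_mul] at hyu
    rw [Nat.mod_eq_of_lt hyu]
    simpa using hyP
  · have hgw := hV.glue w (by omega)
    have habove' : ∀ j, V w ((w + 1) * n + j) = V 0 ((w + 1) * n + j) := fun j =>
      eq_of_glue hV.glue (by omega) (by omega)
    have hlt := hV.lt w hu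
    refine hyP.trans (add_le_add_left ?_ _)
    rw [← habove']
    rcases lt_or_ge y (p (w + 1) + n) with h | h
    · exact (hgw.window y (by omega) h).le
    · obtain ⟨z, rfl⟩ : ∃ z, y = z + n := ⟨y - n, by omega⟩
      rw [Nat.succ_mul (w + 1)] at hyu
      rw [hgw.right z (by omega) (by omega), Nat.add_mod_right]
      exact (lt_of_tilde_max hn (cyclicBlock_congr hn (fun j _ => (habove' j).symm)
        (hV.block (w + 1) (by omega))) (hV.tilde w (by omega)) (by omega) (by omega)).2.le

lemma LayeredPath.admissibleSeq (hn : 0 < n) (hd : 0 < d) (hV : LayeredPath d n m p V)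
    (hres : ResidueSeq n m (d * n) (V 0)) : AdmissibleSeq d n m (V 0) :=
  ⟨hres, hV.zero 0 hd, hV.nonneg 0 hd, hV.block, fun _ hu => hV.linkedBlock hn hu⟩

end

section

/-! ### The rank vectors of the two maps -/

variable {d n m : ℕ} {p : ℕ → ℕ} {q : ℕ → ℤ} {V : ℕ → ℕ → ℤ}

lemma permComp_apply_of_lt (n : ℕ) (p : ℕ → ℕ) (j : ℕ) {k a : ℕ} (h : k < a) :
    permComp n p j k a = a := by
  induction k with
  | zero => rfl
  | succ k ih =>
    rw [permComp, Equiv.Perm.mul_apply, ih (by omega)]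
    simp only [cyc, Equiv.coe_fn_mk]
    rw [if_neg (by omega), if_neg (by omega)]

lemma perm_le_of_fix {σ : Equiv.Perm ℕ} {k : ℕ} (h : ∀ a, k < a → σ a = a) {a : ℕ} (ha : a ≤ k) :
    σ a ≤ k := by
  by_contra hc
  have := σ.injective (h (σ a) (by omega))
  omega

lemma perm_apply_inv (σ : Equiv.Perm ℕ) (a : ℕ) : σ (σ⁻¹ a) = a := σ.apply_symm_apply a

lemma perm_inv_apply (σ : Equiv.Perm ℕ) (a : ℕ) : σ⁻¹ (σ a) = a := σ.symm_apply_apply a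

lemma permComp_lt (n : ℕ) (p : ℕ → ℕ) (j : ℕ) {k a : ℕ} (hk : k < d) (ha : a < d) :
    permComp n p j k a < d := by
  have := perm_le_of_fix (σ := permComp n p j k) (k := d - 1) (a := a)
    (fun a h => permComp_apply_of_lt n p j (by omega)) (by omega)
  omega

lemma permComp_inv_lt (n : ℕ) (p : ℕ → ℕ) (j : ℕ) {k a : ℕ} (hk : k < d) (ha : a < d) :
    (permComp n p j k)⁻¹ a < d := by
  have := perm_le_of_fix (σ := (permComp n p j k)⁻¹) (k := d - 1) (a := a)
    (fun a h => Equiv.Perm.inv_eq_iff_eq.2 (permComp_apply_of_lt n p j (by omega)).symm)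
    (by omega)
  omega

lemma permComp_congr {p p' : ℕ → ℕ} {j k : ℕ} (h : ∀ u, 1 ≤ u → u ≤ k → p u = p' u) :
    permComp n p j k = permComp n p' j k := by
  induction k with
  | zero => rfl
  | succ k ih =>
    rw [permComp, permComp, ih fun u hu hk => h u hu (by omega)]
    simp only [permIndex, h (k + 1) (by omega) le_rfl]

/-- Replacing row `σ(i)` by row `i` changes `m x` by `-(σ(i) - i) n m`, and the correction of the
height compensates exactly this. The maps therefore permute ranks without altering them. -/
lemma colRank_twist (m : ℕ) {c c' : Fin d → Fin n → ℤ} (σ : ℕ → Equiv.Perm ℕ)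
    (hc : ∀ i j, c' i j = entry c (σ j i) j - ((σ j i : ℤ) - (i : ℕ)) * m) {x : ℕ}
    (hx : x < d * n) :
    colRank n m c' x = colRank n m c (σ (x % n) (x / n) * n + x % n) := by
  have hn := pos_of_lt_mul hx
  have h := hc ⟨x / n, div_lt hx⟩ ⟨x % n, Nat.mod_lt _ hn⟩
  rw [entry_eq_flat _ (Nat.mod_lt _ hn), ← flat_mul_add c'] at h
  simp only [div_mul_add_mod] at h
  simp only [colRank, rk, h]
  have hxx : (x : ℤ) = (x / n : ℕ) * n + (x % n : ℕ) := by exact_mod_cast (div_mul_add_mod n x).symm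
  generalize x / n = i at *
  generalize x % n = j at *
  push_cast
  rw [hxx]
  ring

lemma colRank_injective {c c' : Fin d → Fin n → ℤ}
    (h : ∀ x < d * n, colRank n m c x = colRank n m c' x) : c = c' := by
  funext i j
  have hx := mul_add_lt i.2 j.2
  have := h _ hx
  simp only [colRank, rk, flat_mul_add] at this
  have hn : (n : ℤ) ≠ 0 := by exact_mod_cast (pos_of_lt_mul hx).ne'
  exact mul_left_cancel₀ hn (by linarith)

lemma colRank_phiMatrix (c : Fin d → Fin n → ℤ) {x : ℕ} (hx : x < d * n) :
    colRank n m (phiMatrix d n m c) x =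
      tower n (tildeMoveIndex d n m c) (colRank n m c) (d - 1) x :=
  colRank_twist m (fun j => (tildeSPerm d n m c j)⁻¹) (fun _ _ => rfl) hx

lemma colRank_psiMatrix (y : Fin d → Fin n → ℤ) {x : ℕ} (hx : x < d * n) :
    colRank n m (psiMatrix d n m y) x =
      colRank n m y (sPerm d n m y (x % n) (x / n) * n + x % n) :=
  colRank_twist m (sPerm d n m y) (fun _ _ => rfl) hx

lemma tower_index_lt (n : ℕ) (p : ℕ → ℕ) {u x : ℕ} (hu : u < d) (hx : x < d * n) :
    (permComp n p (x % n) u)⁻¹ (x / n) * n + x % n < d * n :=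
  mul_add_lt (permComp_inv_lt n p _ hu (div_lt hx)) (Nat.mod_lt _ (pos_of_lt_mul hx))

lemma tower_psiMatrix (hd : 0 < d) (y : Fin d → Fin n → ℤ) {x : ℕ} (hx : x < d * n) :
    tower n (moveIndex d n m y) (colRank n m (psiMatrix d n m y)) (d - 1) x = colRank n m y x := by
  have hj := Nat.mod_lt x (pos_of_lt_mul hx)
  rw [tower, colRank_psiMatrix y (tower_index_lt n _ (by omega) hx), mul_add_div_self hj,
    mul_add_mod_self hj, sPerm, perm_apply_inv, div_mul_add_mod]

lemma sSup_le_of_forall {s : Set ℕ} {b : ℕ} (h : ∀ x ∈ s, x ≤ b) : sSup s ≤ b := by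
  rcases s.eq_empty_or_nonempty with rfl | hs
  · simp
  · exact csSup_le hs h

lemma moveIndex_le (y : Fin d → Fin n → ℤ) (u : ℕ) : moveIndex d n m y u ≤ u * n :=
  sSup_le_of_forall fun _ hx => hx.1

lemma tildeMoveIndex_le (c : Fin d → Fin n → ℤ) (u : ℕ) : tildeMoveIndex d n m c u ≤ u * n :=
  sSup_le_of_forall fun _ hx => by
    obtain ⟨y, rfl, hy, -⟩ := tildeMoveSet_le hx
    exact hy

lemma tildeRankVec_eq_tower (hn : 0 < n) (c : Fin d → Fin n → ℤ) (u : ℕ) :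
    tildeRankVec d n m c u = tower n (tildeMoveIndex d n m c) (colRank n m c) u := by
  induction u with
  | zero => rw [tower_zero]; rfl
  | succ u ih =>
    have hg := glue_tower (q := colRank n m c) hn (tildeMoveIndex_le (m := m) c (u + 1))
    have hp : tildeMoveIndex d n m c (u + 1) =
      sSup (tildeMoveSet n m (tildeRankVec d n m c u) (u + 1)) := rfl
    funext x
    simp only [tildeRankVec]
    rw [← hp, ih]
    have hle := hg.le
    split_ifs with h1 h2
    · rcases h1 with h1 | h1
      · rw [hg.left x h1]
      · rw [hg.above x h1]
    · push Not at h1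
      obtain ⟨z, rfl⟩ : ∃ z, x = z + n := ⟨x - n, by omega⟩
      rw [show (u + 2) * n = (u + 1) * n + n by ring] at h1
      rw [hg.right z (by omega) (by omega), Nat.add_sub_cancel]
    · push Not at h1
      rw [hg.window x h1.1 (by omega)]

lemma moveSet_congr (hn : 0 < n) {r r' : ℕ → ℤ} {u : ℕ} (h : ∀ x < (u + 1) * n, r x = r' x) :
    moveSet n m r u = moveSet n m r' u := by
  ext x
  rw [Nat.succ_mul] at h
  constructor <;> rintro ⟨h1, h2⟩
  · rw [h _ (by omega), h _ (by omega)] at h2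
    exact ⟨h1, h2⟩
  · rw [← h _ (by omega), ← h _ (by omega)] at h2
    exact ⟨h1, h2⟩

/-- Successive deletion retraces a glued family once the move indices agree. The hypothesis `hp` may
use the equality at the current stage: for `Φ_d` the index is only known through it. -/
lemma rankVec_eq (hd : 0 < d) (y : Fin d → Fin n → ℤ)
    (hg : ∀ u, u + 1 < d → Glue n (u + 1) (p (u + 1)) (V u) (V (u + 1)))
    (hV : ∀ x < d * n, V (d - 1) x = colRank n m y x)
    (hp : ∀ k u, k + u + 2 = d → (∀ x < (u + 2) * n, rankVec d n m y k x = V (u + 1) x) →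
      sSup (moveSet n m (rankVec d n m y k) (u + 1)) = p (u + 1)) {k u : ℕ} (hk : k + u + 1 = d) :
    ∀ x < (u + 1) * n, rankVec d n m y k x = V u x := by
  induction k generalizing u with
  | zero =>
    intro x hx
    obtain rfl : u = d - 1 := by omega
    rw [hV x (by rwa [Nat.sub_add_cancel hd] at hx)]
    rfl
  | succ k ih =>
    intro x hx
    have ih' := ih (u := u + 1) (by omega)
    have hgu := hg u (by omega)
    simp only [rankVec]
    rw [show d - 1 - k = u + 1 by omega, hp k u (by omega) ih']
    rw [Nat.succ_mul (u + 1)] at ih'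
    have hle := hgu.le
    split_ifs with h
    · rw [ih' x (by omega), hgu.left x h]
    · rw [ih' _ (by omega), hgu.right x (by omega) hx]

/-! ### Dyck paths in terms of rank sequences -/

/-- As `â_{i,j} = d m (i n + j) + i` with `i < d`, the summand `i` is invisible to the bound, which
only says that the rank is nonnegative. -/
lemma aFloor_eq (hn : 0 < n) (i : Fin d) (j : ℕ) (t : ℤ) :
    t ≤ aFloor d n m i j ↔ n * t ≤ m * (i * n + j : ℕ) := by
  have hd : 0 < d := i.pos
  have hi : ((i : ℕ) : ℤ) < d := by exact_mod_cast i.2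
  have hdn : (0 : ℤ) < d * n := by positivity
  have hd' : (0 : ℤ) < d := by positivity
  rw [aFloor, Int.le_ediv_iff_mul_le hdn]
  have h1 : aHat d n m i j = d * (m * (i * n + j : ℕ)) + (i : ℕ) := by
    simp only [aHat]
    push_cast
    ring
  rw [h1]
  constructor
  · intro h
    by_contra hc
    push Not at hc
    have : (d : ℤ) * (m * (i * n + j : ℕ) + 1) ≤ d * (n * t) :=
      mul_le_mul_of_nonneg_left hc hd'.le
    have h3 : t * (d * n) = d * (n * t) := by ring
    linarith
  · intro h
    have : (d : ℤ) * (n * t) ≤ d * (m * (i * n + j : ℕ)) := mul_le_mul_of_nonneg_left h hd'.le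
    have h3 : t * (d * n) = d * (n * t) := by ring
    have : (0 : ℤ) ≤ (i : ℕ) := by positivity
    linarith

/-- Since `rk` drops by `n` per unit of height, monotone heights mean steps of at most `m`. The
lower bound on the heights reduces to `y_0 = 0` by monotonicity. -/
lemma mem_dyckPaths_iff (hd : 0 < d) (hn : 0 < n) (y : Fin d → Fin n → ℤ) :
    y ∈ dyckPaths d n m ↔ colRank n m y 0 = 0 ∧ (∀ x < d * n, 0 ≤ colRank n m y x) ∧
      StepPath m (d * n) (colRank n m y) := by
  have hn' : (0 : ℤ) < n := by exact_mod_cast hn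
  have h00 : 0 < d * n := by positivity
  have hmono : (∀ x, x + 1 < d * n → flat y x ≤ flat y (x + 1)) ↔
      StepPath m (d * n) (colRank n m y) := by
    refine forall₂_congr fun x hx => ?_
    simp only [colRank, rk]
    push_cast
    constructor
    · intro h
      have := mul_le_mul_of_nonneg_left h hn'.le
      linarith
    · intro h
      exact le_of_mul_le_mul_left (by linarith) hn'
  have hnn : (∀ i j, y i j ≤ aFloor d n m i j) ↔ ∀ x < d * n, 0 ≤ colRank n m y x := by
    constructor
    · intro h x hx
      have := (aFloor_eq hn _ _ _).1 (h ⟨x / n, div_lt hx⟩ ⟨x % n, Nat.mod_lt _ hn⟩)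
      rw [← flat_mul_add y] at this
      simp only [div_mul_add_mod] at this
      simpa [colRank, rk] using this
    · intro h i j
      rw [aFloor_eq hn]
      have := h _ (mul_add_lt i.2 j.2)
      simpa only [colRank, rk, flat_mul_add, sub_nonneg] using this
  have hzero : colRank n m y 0 = 0 ↔ flat y 0 = 0 := by
    simp [colRank, rk, hn.ne']
  constructor
  · rintro ⟨h1, h2⟩
    have h3 := hnn.1 fun i j => (h1 i j).2
    refine ⟨?_, h3, hmono.1 h2⟩
    rw [hzero]
    have h4 := h3 0 h00
    have h5 := (h1 ⟨0, hd⟩ ⟨0, hn⟩).1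
    rw [← flat_mul_add y] at h5
    simp only [zero_mul, add_zero] at h5
    simp only [colRank, rk] at h4
    by_contra hc
    have : 0 < flat y 0 := lt_of_le_of_ne h5 (Ne.symm hc)
    have := mul_pos hn' this
    push_cast at h4
    linarith
  · rintro ⟨h1, h2, h3⟩
    have h4 := hmono.2 h3
    have hfl : ∀ x < d * n, 0 ≤ flat y x := by
      intro x
      induction x with
      | zero => intro _; exact (hzero.1 h1).ge
      | succ x ih => intro hx; exact (ih (by omega)).trans (h4 x hx)
    refine ⟨fun i j => ⟨?_, hnn.2 h2 i j⟩, h4⟩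
    rw [← flat_mul_add y]
    exact hfl _ (mul_add_lt i.2 j.2)

/-! ### The two maps are mutually inverse -/

/-- The family of sequences attached to a Dyck path. -/
noncomputable def psiTower (d n m : ℕ) (y : Fin d → Fin n → ℤ) : ℕ → ℕ → ℤ :=
  tower n (moveIndex d n m y) (colRank n m (psiMatrix d n m y))

/-- The family of sequences attached to the matrix of an admissible subset. -/
noncomputable def phiTower (d n m : ℕ) (c : Fin d → Fin n → ℤ) : ℕ → ℕ → ℤ :=
  tower n (tildeMoveIndex d n m c) (colRank n m c)

lemma rankVec_eq_psiTower (hd : 0 < d) (hn : 0 < n) (y : Fin d → Fin n → ℤ) {k u : ℕ}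
    (hk : k + u + 1 = d) : ∀ x < (u + 1) * n, rankVec d n m y k x = psiTower d n m y u x := by
  refine rankVec_eq hd y (fun u _ => glue_tower hn (moveIndex_le y (u + 1)))
    (fun x hx => tower_psiMatrix hd y hx) (fun k u hk _ => ?_) hk
  rw [moveIndex, show d - (u + 1) - 1 = k by omega]

lemma moveIndex_eq (hd : 0 < d) (hn : 0 < n) (y : Fin d → Fin n → ℤ) {u : ℕ} (hu : u + 1 < d) :
    moveIndex d n m y (u + 1) = sSup (moveSet n m (psiTower d n m y (u + 1)) (u + 1)) := by
  rw [moveIndex, moveSet_congr hn (rankVec_eq_psiTower hd hn y (by omega))]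

lemma layeredPath_psiTower (hd : 0 < d) (hn : 0 < n) {y : Fin d → Fin n → ℤ}
    (hy : y ∈ dyckPaths d n m) : LayeredPath d n m (moveIndex d n m y) (psiTower d n m y) := by
  obtain ⟨h1, h2, h3⟩ := (mem_dyckPaths_iff hd hn y).1 hy
  have heq : ∀ x < d * n, psiTower d n m y (d - 1) x = colRank n m y x :=
    fun x hx => tower_psiMatrix hd y hx
  have hq : ∀ x < d * n, 0 ≤ colRank n m (psiMatrix d n m y) x := by
    intro x hx
    rw [colRank_psiMatrix y hx]
    exact h2 _ (mul_add_lt (permComp_lt n _ _ (by omega) (div_lt hx)) (Nat.mod_lt _ hn))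
  refine layeredPath_of_path hn hd (fun u _ => glue_tower hn (moveIndex_le y (u + 1)))
    ?_ ?_ ?_ (fun u hu => moveIndex_eq hd hn y hu)
  · rw [heq 0 (by positivity), h1]
  · intro u hu x hx
    exact hq _ (tower_index_lt n _ hu hx)
  · intro x hx
    rw [heq _ hx, heq _ (by omega)]
    exact h3 x hx

lemma layeredPath_phiTower (hn : 0 < n) {c : Fin d → Fin n → ℤ}
    (hc : AdmissibleSeq d n m (colRank n m c)) :
    LayeredPath d n m (tildeMoveIndex d n m c) (phiTower d n m c) := by
  refine layeredPath_of_admissible hn (fun u _ => glue_tower hn (tildeMoveIndex_le c (u + 1)))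
    ?_ ?_ ?_
  · intro u hu x hx
    exact hc.nonneg _ (tower_index_lt n _ hu hx)
  · rw [phiTower, tower_zero]
    exact hc
  · intro u _
    rw [phiTower, ← tildeRankVec_eq_tower hn]
    rfl

lemma psiTower_zero (y : Fin d → Fin n → ℤ) :
    psiTower d n m y 0 = colRank n m (psiMatrix d n m y) := tower_zero _ _ _

lemma admissibleSeq_psiMatrix (hd : 0 < d) (hn : 0 < n) {y : Fin d → Fin n → ℤ}
    (hy : y ∈ dyckPaths d n m) : AdmissibleSeq d n m (colRank n m (psiMatrix d n m y)) := by
  have := (layeredPath_psiTower hd hn hy).admissibleSeq hn hd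
  rw [psiTower_zero] at this
  exact this (colRank_residueSeq _ _ _ _)

lemma phiMatrix_mem_dyckPaths (hd : 0 < d) (hn : 0 < n) {c : Fin d → Fin n → ℤ}
    (hc : AdmissibleSeq d n m (colRank n m c)) : phiMatrix d n m c ∈ dyckPaths d n m := by
  have hV := layeredPath_phiTower hn hc
  have heq : ∀ x < d * n, colRank n m (phiMatrix d n m c) x = phiTower d n m c (d - 1) x :=
    fun x hx => colRank_phiMatrix c hx
  rw [mem_dyckPaths_iff hd hn]
  refine ⟨?_, ?_, ?_⟩
  · rw [heq 0 (by positivity)]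
    exact hV.zero _ (by omega)
  · intro x hx
    rw [heq x hx]
    exact hV.nonneg _ (by omega) x hx
  · have := hV.step (d - 1) (by omega)
    rw [Nat.sub_add_cancel hd] at this
    intro x hx
    rw [heq _ hx, heq _ (by omega)]
    exact this x hx

/-- Induction on the stage: if the first `k` insertion indices equal the move indices, both towers
agree at stage `k`, where the next move index is also the maximal place of insertion. -/
lemma phiMatrix_psiMatrix (hd : 0 < d) (hn : 0 < n) {y : Fin d → Fin n → ℤ}
    (hy : y ∈ dyckPaths d n m) : phiMatrix d n m (psiMatrix d n m y) = y := by
  have hV := layeredPath_psiTower hd hn hy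
  have hp : ∀ k, k < d → ∀ u, 1 ≤ u → u ≤ k →
      tildeMoveIndex d n m (psiMatrix d n m y) u = moveIndex d n m y u := by
    intro k
    induction k with
    | zero => omega
    | succ k ih =>
      intro hk u h1 h2
      rcases Nat.lt_or_ge u (k + 1) with h | h
      · exact ih (by omega) u h1 (by omega)
      · obtain rfl : u = k + 1 := by omega
        rw [← (hV.tilde k hk).csSup_eq, tildeMoveIndex, Nat.add_sub_cancel,
          tildeRankVec_eq_tower hn]
        congr 2
        funext x
        simp only [tower, psiTower]
        rw [permComp_congr (ih (by omega))]
  refine colRank_injective (m := m) fun x hx => ?_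
  rw [colRank_phiMatrix _ hx, ← tower_psiMatrix hd y hx, tower, tower,
    permComp_congr (hp (d - 1) (by omega))]

/-- Here the comparison runs from the full path downwards: at each stage the insertion index is the
last closing window of the glued path, so the same block is deleted again. -/
lemma moveIndex_phiMatrix (hd : 0 < d) (hn : 0 < n) {c : Fin d → Fin n → ℤ}
    (hc : AdmissibleSeq d n m (colRank n m c)) {u : ℕ} (hu : u + 1 < d) :
    moveIndex d n m (phiMatrix d n m c) (u + 1) = tildeMoveIndex d n m c (u + 1) := by
  have hV := layeredPath_phiTower hn hc
  have hsup : ∀ k u, k + u + 2 = d →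
      (∀ x < (u + 2) * n, rankVec d n m (phiMatrix d n m c) k x = phiTower d n m c (u + 1) x) →
      sSup (moveSet n m (rankVec d n m (phiMatrix d n m c) k) (u + 1)) =
        tildeMoveIndex d n m c (u + 1) := by
    intro k u hk h
    rw [moveSet_congr hn h, (hV.move u (by omega)).csSup_eq]
  rw [moveIndex]
  refine hsup _ _ (by omega) ?_
  exact rankVec_eq hd _ hV.glue (fun x hx => (colRank_phiMatrix c hx).symm) hsup
    (u := u + 1) (by omega)

lemma psiMatrix_phiMatrix (hd : 0 < d) (hn : 0 < n) {c : Fin d → Fin n → ℤ}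
    (hc : AdmissibleSeq d n m (colRank n m c)) : psiMatrix d n m (phiMatrix d n m c) = c := by
  refine colRank_injective (m := m) fun x hx => ?_
  have hj := Nat.mod_lt x hn
  have hs : sPerm d n m (phiMatrix d n m c) (x % n) = tildeSPerm d n m c (x % n) := by
    refine permComp_congr fun u h1 h2 => ?_
    obtain ⟨u, rfl⟩ : ∃ v, u = v + 1 := ⟨u - 1, by omega⟩
    exact moveIndex_phiMatrix hd hn hc (by omega)
  have hlt := mul_add_lt (permComp_lt n (tildeMoveIndex d n m c) (x % n) (k := d - 1) (by omega)
    (div_lt hx)) hj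
  rw [colRank_psiMatrix _ hx, hs, tildeSPerm, colRank_phiMatrix _ hlt, tower,
    mul_add_div_self hj, mul_add_mod_self hj, perm_inv_apply, div_mul_add_mod]

end

section

/-! ### Counting functions -/

/-- The number of `l ≥ 1` with `n l ≤ t`. -/
def stepCount (n : ℕ) (t : ℤ) : ℤ := max 0 (t / n)

/-- The number of `l ≥ 1` with `t - m - ε < n l ≤ t - ε`. -/
def stepDiff (n m : ℕ) (t ε : ℤ) : ℤ := stepCount n (t - ε) - stepCount n (t - m - ε)

/-- The contribution to the statistics that depends on the order of two generators. -/
def orderTerm (n m : ℕ) (t : ℤ) : ℤ := stepDiff n m t 1 - stepDiff n m t 0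

variable {d n m : ℕ} {p : ℕ → ℕ} {q r : ℕ → ℤ} {V : ℕ → ℕ → ℤ}

lemma stepCount_sub_one (hn : 0 < n) (t : ℤ) :
    stepCount n t - stepCount n (t - 1) = if (n : ℤ) ∣ t ∧ 0 < t then 1 else 0 := by
  have hn' : (0 : ℤ) < n := by exact_mod_cast hn
  simp only [stepCount]
  by_cases h : (n : ℤ) ∣ t
  · obtain ⟨s, rfl⟩ := h
    have h1 : ((n : ℤ) * s) / n = s := Int.mul_ediv_cancel_left _ hn'.ne'
    have h2 : ((n : ℤ) * s - 1) / n = s - 1 := by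
      rw [show (n : ℤ) * s - 1 = -1 + n * s by ring, Int.add_mul_ediv_left _ _ hn'.ne']
      have : (-1 : ℤ) / n = -1 := by
        rw [Int.ediv_eq_iff_of_pos hn']
        omega
      omega
    have h3 : 0 < (n : ℤ) * s ↔ 0 < s := by
      constructor
      · intro h; exact pos_of_mul_pos_right h hn'.le
      · intro h; positivity
    rw [h1, h2]
    simp only [dvd_mul_right, true_and, h3]
    split_ifs <;> omega
  · rw [if_neg (fun hc => h hc.1)]
    have h1 := Int.emod_add_mul_ediv t n
    have h2 := Int.emod_nonneg t hn'.ne'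
    have h3 := Int.emod_lt_of_pos t hn'
    have h4 : t % n ≠ 0 := fun hc => h (Int.dvd_of_emod_eq_zero hc)
    have h5 : (t - 1) / n = t / n := by
      rw [Int.ediv_eq_iff_of_pos hn']
      constructor
      · rw [mul_comm]; omega
      · rw [mul_comm]; omega
    rw [h5, sub_self]

/-- Shifting `t` by one changes a count only when an endpoint is a multiple of `n`. A pair thus
contributes only if its columns lie in equal or cyclically adjacent residue classes. -/
lemma orderTerm_eq (hn : 0 < n) (t : ℤ) : orderTerm n m t =
    (if (n : ℤ) ∣ t - m ∧ 0 < t - m then 1 else 0) - if (n : ℤ) ∣ t ∧ 0 < t then 1 else 0 := by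
  rw [← stepCount_sub_one hn, ← stepCount_sub_one hn]
  simp only [orderTerm, stepDiff, sub_zero]
  ring

lemma orderTerm_eq_zero (hn : 0 < n) {t : ℤ} (h1 : (n : ℤ) ∣ t - m → t ≤ m)
    (h2 : (n : ℤ) ∣ t → t ≤ 0) : orderTerm n m t = 0 := by
  rw [orderTerm_eq hn, if_neg, if_neg, sub_zero]
  · rintro ⟨h, h'⟩
    have := h2 h
    omega
  · rintro ⟨h, h'⟩
    have := h1 h
    omega

lemma residue_congr (hco : Nat.Coprime n m) {x y : ℕ} {a b : ℤ}
    (ha : (n : ℤ) ∣ a - m * x) (hb : (n : ℤ) ∣ b - m * y) (hab : (n : ℤ) ∣ a - b) :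
    x % n = y % n := by
  have h1 : (n : ℤ) ∣ m * x - m * y := by
    have := dvd_sub (dvd_add hab hb) ha
    exact dvd_trans_eq this (by ring)
  have h2 : (n : ℤ) ∣ (x : ℤ) - y := by
    rw [← mul_sub] at h1
    exact (Nat.isCoprime_iff_coprime.2 hco).dvd_of_dvd_mul_left h1
  exact ((Nat.modEq_iff_dvd.2 h2).symm : x ≡ y [MOD n])

/-- Generators of a cyclic block do not contribute, in any order of reading. -/
lemma orderTerm_window (hn : 0 < n) (hco : Nat.Coprime n m) {P : ℕ} {f : ℕ → ℤ}
    (hf : ∀ k < n, (n : ℤ) ∣ f k - m * (P + k : ℕ)) (hcyc : f 0 ≤ f (n - 1) + m) {k k' : ℕ}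
    (hk : k < n) (hk' : k' < k) : orderTerm n m (f k' - f k) = 0 := by
  refine orderTerm_eq_zero hn ?_ ?_
  · intro h
    have h1 := residue_congr hco (x := P + k') (y := P + (k + 1)) (hf k' (by omega))
      (b := f k + m) (dvd_trans_eq (hf k hk) (by push_cast; ring)) (dvd_trans_eq h (by ring))
    have h2 : k' ≡ k + 1 [MOD n] := Nat.ModEq.add_left_cancel' P h1
    -- The class of `k'` follows that of `k` although `k' < k`; this happens only for the last and
    -- the first position, where the closing inequality applies.
    have h3 : k + 1 = n := by
      by_contra hc
      have := h2.eq_of_lt_of_lt (by omega) (by omega)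
      omega
    have h4 : k' = 0 := by
      have : k' ≡ 0 [MOD n] := by
        rw [h3] at h2
        exact h2.trans (by simp [Nat.ModEq])
      exact this.eq_of_lt_of_lt (by omega) hn
    rw [h4, show k = n - 1 by omega]
    linarith
  · intro h
    have h1 := residue_congr hco (hf k' (by omega)) (hf k hk) h
    have h2 : k' ≡ k [MOD n] := Nat.ModEq.add_left_cancel' P h1
    have := h2.eq_of_lt_of_lt (by omega) hk
    omega

/-! ### Order sums over positions and over layers -/

lemma sum_range_mul (f : ℕ → ℤ) (d n : ℕ) :
    ∑ x ∈ Finset.range (d * n), f x = ∑ u ∈ Finset.range d, ∑ j ∈ Finset.range n, f (u * n + j) := by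
  induction d with
  | zero => simp
  | succ d ih => rw [Nat.succ_mul, Finset.sum_range_add, ih, Finset.sum_range_succ]

lemma sum_window_mod (f : ℕ → ℤ) (hn : 0 < n) (P : ℕ) :
    ∑ k ∈ Finset.range n, f ((P + k) % n) = ∑ j ∈ Finset.range n, f j := by
  refine Finset.sum_bij (fun k _ => (P + k) % n) ?_ ?_ ?_ (fun _ _ => rfl)
  · intro k _
    exact Finset.mem_range.2 (Nat.mod_lt _ hn)
  · intro k hk k' hk' h
    rw [Finset.mem_range] at hk hk'
    have : k ≡ k' [MOD n] := Nat.ModEq.add_left_cancel' P h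
    exact this.eq_of_lt_of_lt hk hk'
  · intro j hj
    obtain ⟨x, h1, h2, h3⟩ := mod_shift (P := P) hn (Finset.mem_range.1 hj)
    exact ⟨x - P, Finset.mem_range.2 (by omega), by rw [← h3]; congr 1; omega⟩

/-- The position in the longer sequence of the entry `x` of the shorter one. -/
def skip (n P x : ℕ) : ℕ := if x < P then x else x + n

lemma sum_skip (F : ℕ → ℤ) {L P : ℕ} (hP : P ≤ L) :
    ∑ x ∈ Finset.range (L + n), F x =
      ∑ x ∈ Finset.range L, F (skip n P x) + ∑ k ∈ Finset.range n, F (P + k) := by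
  obtain ⟨e, rfl⟩ : ∃ e, L = P + e := ⟨L - P, by omega⟩
  rw [show P + e + n = P + n + e by ring, Finset.sum_range_add, Finset.sum_range_add,
    Finset.sum_range_add]
  have h1 : ∑ x ∈ Finset.range P, F (skip n P x) = ∑ x ∈ Finset.range P, F x :=
    Finset.sum_congr rfl fun x hx => by rw [skip, if_pos (Finset.mem_range.1 hx)]
  have h2 : ∑ x ∈ Finset.range e, F (skip n P (P + x)) = ∑ x ∈ Finset.range e, F (P + n + x) :=
    Finset.sum_congr rfl fun x _ => by
      rw [skip, if_neg (by omega)]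
      congr 1
      omega
  rw [h1, h2]
  ring

lemma Glue.apply_skip {u P : ℕ} (hg : Glue n u P q r) {x : ℕ} (hx : x < u * n) :
    r (skip n P x) = q x := by
  rw [skip]
  split_ifs with h
  · exact hg.left x h
  · exact hg.right x (by omega) hx

lemma Glue.sum_window {u P : ℕ} (hn : 0 < n) (hg : Glue n u P q r) (f : ℤ → ℤ) :
    ∑ k ∈ Finset.range n, f (r (P + k)) = ∑ j ∈ Finset.range n, f (q (u * n + j)) := by
  rw [← sum_window_mod (fun j => f (q (u * n + j))) hn P]
  refine Finset.sum_congr rfl fun k hk => ?_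
  rw [Finset.mem_range] at hk
  rw [hg.window (P + k) (by omega) (by omega)]

lemma Glue.sum_eq {u P : ℕ} (hn : 0 < n) (hg : Glue n u P q r) (f : ℤ → ℤ) :
    ∑ x ∈ Finset.range ((u + 1) * n), f (r x) = ∑ x ∈ Finset.range ((u + 1) * n), f (q x) := by
  rw [Nat.succ_mul, sum_skip _ hg.le, Finset.sum_range_add, hg.sum_window hn]
  congr 1
  exact Finset.sum_congr rfl fun x hx => by rw [hg.apply_skip (Finset.mem_range.1 hx)]

/-- The sum of the order terms over all pairs of generators in the order of their positions. -/
def positionSum (n m : ℕ) (r : ℕ → ℤ) (L : ℕ) : ℤ :=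
  ∑ x ∈ Finset.range L, ∑ x' ∈ Finset.range L, if x' < x then orderTerm n m (r x' - r x) else 0

/-- The sum of the order terms over the pairs of a generator in the layer `u` and one in an
earlier layer. -/
def layerSum (n m : ℕ) (q : ℕ → ℤ) (u : ℕ) : ℤ :=
  ∑ x ∈ Finset.range (u * n), ∑ j ∈ Finset.range n, orderTerm n m (q x - q (u * n + j))

/-- An entry behind the insertion point is small compared with the block. Read before the block, it
contributes nothing to any pair. Read after it, exactly two block entries contribute: the one in the
next class gives `1`, the one in the same class gives `-1`. -/
lemma sum_orderTerm_after (hn : 0 < n) (hco : Nat.Coprime n m) {u x : ℕ}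
    (hb : CyclicBlock n m q u) (hq : ∀ j < n, (n : ℤ) ∣ q (u * n + j) - m * j)
    (hx : (n : ℤ) ∣ q x - m * x) (h1 : q x + m < q (u * n + (x + 1) % n))
    (h2 : q x < q (u * n + x % n)) :
    ∑ j ∈ Finset.range n, orderTerm n m (q x - q (u * n + j)) = 0 ∧
      ∑ j ∈ Finset.range n, orderTerm n m (q (u * n + j) - q x) = 0 := by
  constructor
  · refine Finset.sum_eq_zero fun j hj => orderTerm_eq_zero hn ?_ ?_
    · rw [Finset.mem_range] at hj
      intro h
      have h3 := residue_congr hco (y := j + 1) (b := q (u * n + j) + m) hx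
        (dvd_trans_eq (hq j hj) (by push_cast; ring)) (dvd_trans_eq h (by ring))
      have h4 := hb j hj
      rw [← h3] at h4
      linarith
    · rw [Finset.mem_range] at hj
      intro h
      have h3 := residue_congr hco hx (hq j hj) h
      rw [Nat.mod_eq_of_lt hj] at h3
      rw [← h3]
      linarith
  · simp only [orderTerm_eq hn]
    rw [Finset.sum_sub_distrib, sub_eq_zero]
    trans (1 : ℤ)
    · rw [Finset.sum_eq_single ((x + 1) % n)]
      · have hj : (x + 1) % n < n := Nat.mod_lt _ hn
        rw [if_pos]
        refine ⟨?_, by linarith⟩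
        have h3 := hq _ hj
        have h4 := dvd_mul_succ_mod n m x
        have h5 := dvd_sub (dvd_add h3 h4) hx
        exact dvd_trans_eq h5 (by ring)
      · intro j hj hne
        rw [Finset.mem_range] at hj
        rw [if_neg]
        rintro ⟨h, -⟩
        refine hne ?_
        have := residue_congr hco (hq j hj) (y := x + 1) (b := q x + m)
          (dvd_trans_eq hx (by push_cast; ring)) (dvd_trans_eq h (by ring))
        rwa [Nat.mod_eq_of_lt hj] at this
      · intro h
        exact absurd (Finset.mem_range.2 (Nat.mod_lt _ hn)) h
    · symm
      rw [Finset.sum_eq_single (x % n)]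
      · have hj : x % n < n := Nat.mod_lt _ hn
        rw [if_pos]
        refine ⟨?_, by linarith⟩
        have h3 := hq _ hj
        have h6 : ((x : ℕ) : ℤ) = n * (x / n : ℕ) + (x % n : ℕ) := by
          exact_mod_cast (Nat.div_add_mod x n).symm
        have h4 : (n : ℤ) ∣ m * (x % n : ℕ) - m * x :=
          ⟨-(m * (x / n : ℕ)), by linear_combination (-(m : ℤ)) * h6⟩
        have h5 := dvd_sub (dvd_add h3 h4) hx
        exact dvd_trans_eq h5 (by ring)
      · intro j hj hne
        rw [Finset.mem_range] at hj
        rw [if_neg]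
        rintro ⟨h, -⟩
        refine hne ?_
        have := residue_congr hco (hq j hj) hx h
        rwa [Nat.mod_eq_of_lt hj] at this
      · intro h
        exact absurd (Finset.mem_range.2 (Nat.mod_lt _ hn)) h

lemma skip_lt_skip {P x x' : ℕ} : skip n P x' < skip n P x ↔ x' < x := by
  simp only [skip]
  split_ifs <;> omega

/-- Entries in front of `P` precede the block before and after the move. Entries behind `P` change
sides, but their total with the block is zero on either side. Pairs inside the window vanish. -/
lemma Glue.positionSum_eq (hn : 0 < n) (hco : Nat.Coprime n m) {u P : ℕ} (hg : Glue n u P q r)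
    (hb : CyclicBlock n m q u) (hP : IsGreatest (tildeMoveSet n m q u) P)
    (hq : ∀ j < n, (n : ℤ) ∣ q (u * n + j) - m * j) (hx : ResidueSeq n m (u * n) q) :
    positionSum n m r ((u + 1) * n) = positionSum n m q (u * n) + layerSum n m q u := by
  have hle := hg.le
  have hin : ∀ x ∈ Finset.range (u * n),
      (∑ x' ∈ Finset.range (u * n + n),
        if x' < skip n P x then orderTerm n m (r x' - r (skip n P x)) else 0) =
      (∑ x' ∈ Finset.range (u * n), if x' < x then orderTerm n m (q x' - q x) else 0) +
        if x < P then 0 else ∑ j ∈ Finset.range n, orderTerm n m (q x - q (u * n + j)) := by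
    intro x hxu
    rw [Finset.mem_range] at hxu
    rw [sum_skip _ hle]
    congr 1
    · refine Finset.sum_congr rfl fun x' hx' => ?_
      rw [hg.apply_skip hxu, hg.apply_skip (Finset.mem_range.1 hx')]
      simp only [skip_lt_skip]
    · rw [hg.apply_skip hxu]
      split_ifs with h
      · refine Finset.sum_eq_zero fun k _ => if_neg ?_
        simp only [skip, if_pos h]
        omega
      · obtain ⟨h1, h2⟩ := lt_of_tilde_max hn hb hP (not_lt.1 h) hxu
        obtain ⟨h3, h4⟩ := sum_orderTerm_after hn hco hb hq (hx x hxu) h1 h2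
        rw [h3, ← h4, ← hg.sum_window hn (fun w => orderTerm n m (w - q x))]
        refine Finset.sum_congr rfl fun k hk => if_pos ?_
        rw [Finset.mem_range] at hk
        simp only [skip, if_neg h]
        omega
  have hout : ∀ k ∈ Finset.range n,
      (∑ x' ∈ Finset.range (u * n + n),
        if x' < P + k then orderTerm n m (r x' - r (P + k)) else 0) =
      ∑ x ∈ Finset.range (u * n), if x < P then orderTerm n m (q x - r (P + k)) else 0 := by
    intro k hk
    rw [Finset.mem_range] at hk
    rw [sum_skip _ hle]
    have h0 : (∑ k' ∈ Finset.range n,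
        if P + k' < P + k then orderTerm n m (r (P + k') - r (P + k)) else 0) = 0 := by
      refine Finset.sum_eq_zero fun k' hk' => ?_
      split_ifs with h
      · refine orderTerm_window hn hco (P := P) (f := fun k => r (P + k)) ?_ ?_ hk (by omega)
        · intro k hk
          have hj : (P + k) % n < n := Nat.mod_lt _ hn
          rw [hg.window (P + k) (by omega) (by omega)]
          have h6 : ((P + k : ℕ) : ℤ) = n * ((P + k) / n : ℕ) + ((P + k) % n : ℕ) := by
            exact_mod_cast (Nat.div_add_mod (P + k) n).symm
          have h4 : (n : ℤ) ∣ m * (P + k : ℕ) - m * ((P + k) % n : ℕ) :=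
            ⟨m * ((P + k) / n : ℕ), by linear_combination (m : ℤ) * h6⟩
          exact dvd_trans_eq (dvd_sub (hq _ hj) h4) (by ring)
        · rw [hg.window (P + 0) (by omega) (by omega),
            hg.window (P + (n - 1)) (by omega) (by omega)]
          have := hb.succ_le hn (P + (n - 1))
          rwa [show P + (n - 1) + 1 = P + 0 + n by omega, Nat.add_mod_right] at this
      · rfl
    rw [h0, add_zero]
    refine Finset.sum_congr rfl fun x hx => ?_
    rw [hg.apply_skip (Finset.mem_range.1 hx)]
    refine if_congr ?_ rfl rfl
    rw [skip]
    split_ifs <;> omega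
  rw [positionSum, Nat.succ_mul, sum_skip _ hle, Finset.sum_congr rfl hin, Finset.sum_congr rfl hout,
    Finset.sum_add_distrib, Finset.sum_comm (s := Finset.range n), add_assoc,
    ← Finset.sum_add_distrib]
  congr 1
  refine Finset.sum_congr rfl fun x _ => ?_
  split_ifs with h
  · rw [zero_add]
    exact hg.sum_window hn (fun w => orderTerm n m (q x - w))
  · simp

/-- A sum over the first blocks is the same at all stages. -/
lemma LayeredPath.sum_eq (hn : 0 < n) (hV : LayeredPath d n m p V) (f : ℤ → ℤ) {u L : ℕ}
    (hu : u < d) (hL : u + 1 ≤ L) :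
    ∑ x ∈ Finset.range (L * n), f (V u x) = ∑ x ∈ Finset.range (L * n), f (V 0 x) := by
  induction u with
  | zero => rfl
  | succ u ih =>
    rw [← ih (by omega) (by omega)]
    have hg := hV.glue u hu
    obtain ⟨e, rfl⟩ : ∃ e, L = u + 1 + 1 + e := ⟨L - (u + 1 + 1), by omega⟩
    rw [add_mul, Finset.sum_range_add, Finset.sum_range_add, hg.sum_eq hn f]
    congr 1
    refine Finset.sum_congr rfl fun x _ => ?_
    rw [hg.above _ (by omega)]

lemma LayeredPath.positionSum_eq (hn : 0 < n) (hco : Nat.Coprime n m)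
    (hV : LayeredPath d n m p V) (hres : ∀ u < d, ResidueSeq n m (d * n) (V u)) {u : ℕ}
    (hu : u < d) : positionSum n m (V u) ((u + 1) * n) =
      ∑ v ∈ Finset.range (u + 1), layerSum n m (V 0) v := by
  have hq : ∀ u < d, ∀ v < d, ∀ j < n, (n : ℤ) ∣ V u (v * n + j) - m * j := by
    intro u hu v hv j hj
    have := (hres u hu).congr_mod (mul_add_lt hv hj)
    rwa [mul_add_mod_self hj] at this
  induction u with
  | zero =>
    have h1 : layerSum n m (V 0) 0 = 0 := by simp [layerSum]
    rw [zero_add, one_mul, Finset.sum_range_one, h1]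
    refine Finset.sum_eq_zero fun k hk => Finset.sum_eq_zero fun k' _ => ?_
    rw [Finset.mem_range] at hk
    split_ifs with h
    · refine orderTerm_window hn hco (P := 0) (f := V 0) ?_ ?_ hk h
      · intro k hk
        simpa using hq 0 hu 0 hu k hk
      · have := hV.block 0 hu (n - 1) (by omega)
        rw [Nat.sub_add_cancel hn, Nat.mod_self] at this
        simpa using this
    · rfl
  | succ u ih =>
    have habove : ∀ j, V u ((u + 1) * n + j) = V 0 ((u + 1) * n + j) := fun j =>
      eq_of_glue hV.glue (by omega) (by omega)
    have hb : CyclicBlock n m (V u) (u + 1) :=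
      cyclicBlock_congr hn (fun j _ => (habove j).symm) (hV.block (u + 1) hu)
    have hle : (u + 1) * n ≤ d * n := Nat.mul_le_mul_right _ (by omega)
    rw [(hV.glue u hu).positionSum_eq hn hco hb (hV.tilde u hu) (hq u (by omega) _ hu)
      (fun x hx => hres u (by omega) x (by omega)), ih (by omega),
      Finset.sum_range_succ _ (u + 1)]
    congr 1
    simp only [layerSum, habove]
    exact hV.sum_eq hn (fun t => ∑ j ∈ Finset.range n,
      orderTerm n m (t - V 0 ((u + 1) * n + j))) (by omega) le_rfl

end

section

/-! ### Gaps of admissible subsets -/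

variable {d n m : ℕ} {p : ℕ → ℕ} {q r : ℕ → ℤ} {V : ℕ → ℕ → ℤ}

/-- The source of the shift `ε` in `stepDiff`: for equal quotients the layers decide the comparison.
-/
lemma lex_le_iff {D K Q i i' : ℤ} (hi : 0 ≤ i) (hiD : i < D) (hi' : 0 ≤ i') (hiD' : i' < D) :
    D * K + i ≤ D * Q + i' ↔ K + (if i' < i then 1 else 0) ≤ Q := by
  rcases lt_trichotomy K Q with h | h | h
  · have : D * (K + 1) ≤ D * Q := mul_le_mul_of_nonneg_left h (by omega)
    rw [mul_add, mul_one] at this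
    split_ifs <;> constructor <;> intro <;> omega
  · subst h
    split_ifs <;> constructor <;> intro <;> omega
  · have : D * (Q + 1) ≤ D * K := mul_le_mul_of_nonneg_left h (by omega)
    rw [mul_add, mul_one] at this
    split_ifs <;> constructor <;> intro <;> omega

lemma le_ediv_iff (hn : 0 < n) (t l : ℤ) : l ≤ t / n ↔ n * l ≤ t := by
  rw [Int.le_ediv_iff_mul_le (by exact_mod_cast hn), mul_comm]

/-- By uniqueness of coordinates, the gaps are the points `l ≥ 1` steps below the generators, and
for each generator one counts the `l` whose point is still at least `a`. -/
lemma ncard_gaps_layerSet (hd : 0 < d) (hn : 0 < n) (hco : Nat.Coprime n m)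
    (hq : ResidueSeq n m (d * n) q) {a i : ℕ} {K : ℤ} (hi : i < d)
    (ha : (a : ℤ) = d * K + i) :
    ((gaps (layerSet d n q) a).ncard : ℤ) = ∑ x ∈ Finset.range (d * n),
      stepCount n (q x - K - if x / n < i then 1 else 0) := by
  set g : ℕ → ℤ := fun x => stepCount n (q x - K - if x / n < i then 1 else 0) with hg
  set S : Finset (Σ _ : ℕ, ℤ) := (Finset.range (d * n)).sigma fun x => Finset.Icc 1 (g x) with hS
  have hmem : ∀ x < d * n, ∀ l : ℤ, 1 ≤ l →
      (l ≤ g x ↔ (a : ℤ) ≤ d * (q x + n * (-l)) + (x / n : ℕ)) := by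
    intro x hx l hl
    have hxd : ((x / n : ℕ) : ℤ) < d := by exact_mod_cast div_lt hx
    have hid : (i : ℤ) < d := by exact_mod_cast hi
    rw [ha, lex_le_iff (by positivity) hid (by positivity) hxd, hg]
    simp only [stepCount, Nat.cast_lt]
    rw [show l ≤ max 0 ((q x - K - if x / n < i then 1 else 0) / (n : ℤ)) ↔
      l ≤ (q x - K - if x / n < i then 1 else 0) / (n : ℤ) by omega, le_ediv_iff hn]
    split_ifs <;> constructor <;> intro <;> linarith
  have himg : gaps (layerSet d n q) a =
      (fun z : Σ _ : ℕ, ℤ => (d * (q z.1 + n * (-z.2)) + (z.1 / n : ℕ)).toNat) '' S := by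
    ext b
    constructor
    · rintro ⟨hab, hb⟩
      obtain ⟨x, hx, k, hk⟩ := hq.exists_coord hd hn hco (b : ℤ)
      rw [coord_mem_layerSet hco hq hx hk, not_le] at hb
      refine ⟨⟨x, -k⟩, ?_, ?_⟩
      · simp only [hS, Finset.coe_sigma, Set.mem_sigma_iff, Finset.coe_range, Set.mem_Iio,
          Finset.coe_Icc, Set.mem_Icc]
        refine ⟨hx, by omega, (hmem x hx _ (by omega)).2 ?_⟩
        rw [neg_neg, ← hk]
        exact_mod_cast hab
      · simp only [neg_neg, ← hk, Int.toNat_natCast]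
    · rintro ⟨⟨x, l⟩, hz, rfl⟩
      simp only [hS, Finset.coe_sigma, Set.mem_sigma_iff, Finset.coe_range, Set.mem_Iio,
        Finset.coe_Icc, Set.mem_Icc] at hz
      obtain ⟨hx, hl, hl'⟩ := hz
      have h1 := (hmem x hx l hl).1 hl'
      have h2 : ((d * (q x + n * (-l)) + (x / n : ℕ)).toNat : ℤ) =
        d * (q x + n * (-l)) + (x / n : ℕ) := Int.toNat_of_nonneg (by omega)
      refine ⟨by exact_mod_cast h1.trans_eq h2.symm, ?_⟩
      rw [coord_mem_layerSet hco hq hx h2]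
      omega
  have hinj : InjOn (fun z : Σ _ : ℕ, ℤ => (d * (q z.1 + n * (-z.2)) + (z.1 / n : ℕ)).toNat) S := by
    rintro ⟨x, l⟩ hz ⟨x', l'⟩ hz' h
    simp only [hS, Finset.coe_sigma, Set.mem_sigma_iff, Finset.coe_range, Set.mem_Iio,
      Finset.coe_Icc, Set.mem_Icc] at hz hz'
    have h1 := (hmem x hz.1 l hz.2.1).1 hz.2.2
    have h2 := (hmem x' hz'.1 l' hz'.2.1).1 hz'.2.2
    simp only at h
    have := hq.coord_unique hco hz.1 hz'.1 (k := -l) (k' := -l') (by omega)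
    obtain ⟨rfl, h3⟩ := this
    obtain rfl : l = l' := by omega
    rfl
  rw [himg, hinj.ncard_image, Set.ncard_coe_finset, hS, Finset.card_sigma]
  push_cast
  refine Finset.sum_congr rfl fun x _ => ?_
  rw [Int.card_Icc]
  have : 0 ≤ g x := le_max_left _ _
  omega

lemma dimSub_layerSet (hd : 0 < d) (hn : 0 < n) (hco : Nat.Coprime n m)
    (hq : ResidueSeq n m (d * n) q) (h0 : ∀ x < d * n, 0 ≤ q x) :
    dimSub d n m (layerSet d n q) = ∑ x ∈ Finset.range (d * n), ∑ x' ∈ Finset.range (d * n),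
      stepDiff n m (q x' - q x) (if x' / n < x / n then 1 else 0) := by
  have hsum : ∀ F : ℕ → ℤ, ∑ᶠ a ∈ generators (d * n) (layerSet d n q), F a =
      ∑ x ∈ Finset.range (d * n), F (layerGen d n q x) := by
    intro F
    rw [generators_layerSet hco hq h0, finsum_mem_image (layerGen_injOn hco hq h0),
      finsum_mem_coe_finset]
  rw [dimSub, hsum, hsum, ← Finset.sum_sub_distrib]
  refine Finset.sum_congr rfl fun x hx => ?_
  rw [Finset.mem_range] at hx
  have hc := layerGen_cast (d := d) (n := n) (h0 x hx)
  rw [ncard_gaps_layerSet hd hn hco hq (div_lt hx) hc,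
    ncard_gaps_layerSet hd hn hco hq (K := q x + m) (div_lt hx)
      (by rw [Nat.cast_add, hc, Nat.cast_mul]; ring), ← Finset.sum_sub_distrib]
  refine Finset.sum_congr rfl fun x' _ => ?_
  rw [stepDiff]
  congr 2
  ring

lemma sum_range_ite_lt (f : ℕ → ℤ) {x L : ℕ} (hx : x ≤ L) :
    ∑ x' ∈ Finset.range L, (if x' < x then f x' else 0) = ∑ x' ∈ Finset.range x, f x' := by
  rw [← Finset.sum_filter]
  congr 1
  ext z
  simp only [Finset.mem_filter, Finset.mem_range]
  omega

/-- The first sum depends only on the multiset of ranks; the layers enter only through the order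
terms of pairs in different layers. -/
lemma dimSub_layerSet_eq (hd : 0 < d) (hn : 0 < n) (hco : Nat.Coprime n m)
    (hq : ResidueSeq n m (d * n) q) (h0 : ∀ x < d * n, 0 ≤ q x) :
    dimSub d n m (layerSet d n q) = (∑ x ∈ Finset.range (d * n), ∑ x' ∈ Finset.range (d * n),
      stepDiff n m (q x' - q x) 0) + ∑ u ∈ Finset.range d, layerSum n m q u := by
  have h1 : ∑ u ∈ Finset.range d, layerSum n m q u =
      ∑ x ∈ Finset.range (d * n), ∑ x' ∈ Finset.range (d * n),
        if x' / n < x / n then orderTerm n m (q x' - q x) else 0 := by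
    rw [sum_range_mul _ d n]
    refine Finset.sum_congr rfl fun u hu => ?_
    rw [Finset.mem_range] at hu
    rw [layerSum, Finset.sum_comm]
    refine Finset.sum_congr rfl fun j hj => ?_
    rw [Finset.mem_range] at hj
    rw [mul_add_div_self hj, ← sum_range_ite_lt _ (Nat.mul_le_mul_right n hu.le)]
    refine Finset.sum_congr rfl fun x _ => ?_
    simp only [Nat.div_lt_iff_lt_mul hn]
  rw [h1, dimSub_layerSet hd hn hco hq h0, ← Finset.sum_add_distrib]
  refine Finset.sum_congr rfl fun x _ => ?_
  rw [← Finset.sum_add_distrib]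
  refine Finset.sum_congr rfl fun x' _ => ?_
  split_ifs
  · rw [orderTerm]
    ring
  · ring

lemma stepCount_colRank {c : Fin d → Fin n → ℤ} (hn : 0 < n) {x : ℕ} (h0 : 0 ≤ colRank n m c x) :
    stepCount n (colRank n m c x) = (m * x : ℤ) / n - flat c x := by
  have hn' : (n : ℤ) ≠ 0 := by positivity
  rw [stepCount, max_eq_right (Int.ediv_nonneg h0 (by positivity))]
  simp only [colRank, rk]
  rw [Int.sub_mul_ediv_left _ _ hn']

lemma deltaInv_layerSet (hd : 0 < d) (hn : 0 < n) (hco : Nat.Coprime n m)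
    {c : Fin d → Fin n → ℤ} (h0 : ∀ x < d * n, 0 ≤ colRank n m c x) :
    deltaInv (layerSet d n (colRank n m c)) =
      ∑ x ∈ Finset.range (d * n), ((m * x : ℤ) / n - flat c x) := by
  have h := ncard_gaps_layerSet hd hn hco (colRank_residueSeq n m (d * n) c) (a := 0) (i := 0)
    (K := 0) hd (by simp)
  have h1 : gaps (layerSet d n (colRank n m c)) 0 = (layerSet d n (colRank n m c))ᶜ := by
    ext b
    simp [gaps]
  rw [h1] at h
  rw [deltaInv, h]
  refine Finset.sum_congr rfl fun x hx => ?_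
  rw [if_neg (Nat.not_lt_zero _), sub_zero, sub_zero, stepCount_colRank hn (h0 x (Finset.mem_range.1 hx))]

lemma size_eq (c : Fin d → Fin n → ℤ) : size c = ∑ x ∈ Finset.range (d * n), flat c x := by
  rw [sum_range_mul, size, Finset.sum_range]
  refine Finset.sum_congr rfl fun i _ => ?_
  rw [Finset.sum_range]
  exact Finset.sum_congr rfl fun j _ => (flat_mul_add c i j).symm

/-! ### The semigroup -/

lemma colRank_zero (x : ℕ) : colRank n m (0 : Fin d → Fin n → ℤ) x = m * x := by
  simp [colRank, rk, flat, entry]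

lemma admissibleSeq_zero (hn : 0 < n) :
    AdmissibleSeq d n m (colRank n m (0 : Fin d → Fin n → ℤ)) := by
  refine ⟨colRank_residueSeq _ _ _ _, by simp [colRank_zero], ?_, ?_, ?_⟩
  · intro x _
    rw [colRank_zero]
    positivity
  · intro u _ j _
    simp only [colRank_zero]
    have h : (u * n + (j + 1) % n : ℕ) ≤ u * n + j + 1 := by
      have := Nat.mod_le (j + 1) n
      omega
    have h' : ((u * n + (j + 1) % n : ℕ) : ℤ) ≤ (u * n + j : ℕ) + 1 := by exact_mod_cast h
    have := mul_le_mul_of_nonneg_left h' (by positivity : (0 : ℤ) ≤ m)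
    linarith
  · intro u _
    refine ⟨n - 1, by omega, ?_⟩
    simp only [colRank_zero]
    rw [Nat.sub_add_cancel hn, Nat.mod_self, add_zero]
    have h' : (((u + 1) * n : ℕ) : ℤ) = (u * n + (n - 1) : ℕ) + 1 := by
      rw [Nat.succ_mul]
      push_cast [Nat.cast_sub hn]
      ring
    rw [h']
    linarith

/-- `Γ` is the admissible subset of the zero matrix. That subset contains `0` and is stable under
`Γ`, hence contains it; conversely, the coordinates of an element are its coefficients on the three
generators. -/
lemma valueSemigroup_eq (hd : 0 < d) (hn : 0 < n) (hco : Nat.Coprime n m) :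
    (valueSemigroup d n m : Set ℕ) = layerSet d n (colRank n m (0 : Fin d → Fin n → ℤ)) := by
  have hadm := (admissibleSeq_zero (d := d) (m := m) hn).isInvariantAdmissible hd hn hco
  have hmem := (mem_admissibleSubsets_iff hd hn hco).2 hadm
  ext a
  constructor
  · intro ha
    exact hmem.2.1 a ha 0 hmem.1
  · rintro ⟨x, hx, k, h⟩
    rw [colRank_zero] at h
    have h1 : a = (x % n) • (d * m) + (x / n) • (d * m * n + 1) + k • (d * n) := by
      have hxx : ((x : ℕ) : ℤ) = (x / n : ℕ) * n + (x % n : ℕ) := by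
        exact_mod_cast (div_mul_add_mod n x).symm
      zify
      rw [h, hxx]
      generalize x / n = i
      simp only [smul_eq_mul]
      push_cast
      ring
    rw [h1]
    have hsub : ∀ g ∈ ({d * n, d * m, d * m * n + 1} : Set ℕ), g ∈ valueSemigroup d n m :=
      fun g hg => AddSubmonoid.subset_closure hg
    exact add_mem (add_mem (nsmul_mem (hsub _ (by simp)) _) (nsmul_mem (hsub _ (by simp)) _))
      (nsmul_mem (hsub _ (by simp)) _)

lemma delta_eq (hd : 0 < d) (hn : 0 < n) (hco : Nat.Coprime n m) :
    delta d n m = ∑ x ∈ Finset.range (d * n), (m * x : ℤ) / n := by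
  rw [delta, valueSemigroup_eq hd hn hco,
    deltaInv_layerSet hd hn hco (admissibleSeq_zero hn).nonneg]
  refine Finset.sum_congr rfl fun x _ => ?_
  simp [flat, entry]

lemma eInv_layerSet (hd : 0 < d) (hn : 0 < n) (hco : Nat.Coprime n m)
    {c : Fin d → Fin n → ℤ} (h0 : ∀ x < d * n, 0 ≤ colRank n m c x) :
    eInv d n m (layerSet d n (colRank n m c)) = size c := by
  rw [eInv, delta_eq hd hn hco, deltaInv_layerSet hd hn hco h0, size_eq, Finset.sum_sub_distrib]
  ring

/-! ### The statistic dinv -/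

lemma card_filter_mul_le (hn : 0 < n) (w : ℕ) (s : ℤ) :
    (((Finset.Icc (1 : ℤ) w).filter fun l => n * l ≤ s).card : ℤ) =
      stepCount n s - stepCount n (s - n * w) := by
  have hn' : (n : ℤ) ≠ 0 := by positivity
  have : (Finset.Icc (1 : ℤ) w).filter (fun l => n * l ≤ s) = Finset.Icc 1 (min (w : ℤ) (s / n)) := by
    ext l
    simp only [Finset.mem_filter, Finset.mem_Icc, le_min_iff, le_ediv_iff hn]
    tauto
  rw [this, Int.card_Icc]
  simp only [stepCount]
  rw [Int.sub_mul_ediv_left _ _ hn']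
  omega

/-- The boxes in the rows of a vertical segment `a < y ≤ b` that are counted by dinv. -/
lemma card_segment (hn : 0 < n) {a b t s s' : ℤ} (hab : a ≤ b) (hs : s' = s + m - n * (b - a)) :
    (((Finset.Ioc a b).filter fun y => s - n * (y - a) ≤ t ∧ t < s' + n * (b - y) + n).card : ℤ) =
      (b - a) - (stepCount n (s - t - 1) - stepCount n (s' - m - t - 1)) -
        (stepCount n (t - s') - stepCount n (t - s - m)) := by
  obtain ⟨w, rfl⟩ : ∃ w : ℕ, b = a + w := ⟨(b - a).toNat, by omega⟩
  have hA : (((Finset.Ioc a (a + w)).filter fun y => ¬ s - n * (y - a) ≤ t).card : ℤ) =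
      stepCount n (s - t - 1) - stepCount n (s' - m - t - 1) := by
    rw [show s' - m - t - 1 = s - t - 1 - n * w by rw [hs]; ring, ← card_filter_mul_le hn]
    congr 1
    refine Finset.card_bij (fun y _ => y - a) ?_ ?_ ?_
    · intro y hy
      simp only [Finset.mem_filter, Finset.mem_Ioc, Finset.mem_Icc] at hy ⊢
      omega
    · intro y _ y' _ h
      omega
    · intro l hl
      simp only [Finset.mem_filter, Finset.mem_Ioc, Finset.mem_Icc] at hl ⊢
      refine ⟨a + l, ⟨by omega, ?_⟩, by ring⟩
      rw [add_sub_cancel_left]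
      omega
  have hB : (((Finset.Ioc a (a + w)).filter fun y => ¬ t < s' + n * (a + w - y) + n).card : ℤ) =
      stepCount n (t - s') - stepCount n (t - s - m) := by
    rw [show t - s - m = t - s' - n * w by rw [hs]; ring, ← card_filter_mul_le hn]
    congr 1
    refine Finset.card_bij (fun y _ => a + w - y + 1) ?_ ?_ ?_
    · intro y hy
      simp only [Finset.mem_filter, Finset.mem_Ioc, Finset.mem_Icc] at hy ⊢
      rw [mul_add, mul_one]
      omega
    · intro y _ y' _ h
      omega
    · intro l hl
      simp only [Finset.mem_filter, Finset.mem_Ioc, Finset.mem_Icc] at hl ⊢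
      refine ⟨a + w - l + 1, ⟨by omega, ?_⟩, by ring⟩
      have : (n : ℤ) * (a + w - (a + w - l + 1)) = n * l - n := by ring
      rw [this]
      omega
  have hcard : (((Finset.Ioc a (a + w)).card : ℕ) : ℤ) = a + w - a := by
    rw [Int.card_Ioc]
    omega
  -- With `v = s - n (y - a)` the condition reads `v ≤ t < v + m + n`, so its two halves cannot fail
  -- together and the failures can be counted separately.
  have hdisj : Disjoint ((Finset.Ioc a (a + w)).filter fun y => ¬ s - n * (y - a) ≤ t)
      ((Finset.Ioc a (a + w)).filter fun y => ¬ t < s' + n * (a + w - y) + n) := by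
    rw [Finset.disjoint_filter]
    intro y hy h1 h2
    rw [Finset.mem_Ioc] at hy
    have h3 : s' + n * (a + w - y) = s + m - n * (y - a) := by rw [hs]; ring
    have : (0 : ℤ) ≤ m := by positivity
    have hn' : (0 : ℤ) < n := by exact_mod_cast hn
    omega
  have hsplit : (((Finset.Ioc a (a + w)).filter fun y =>
      s - n * (y - a) ≤ t ∧ t < s' + n * (a + w - y) + n).card : ℤ) +
      (((Finset.Ioc a (a + w)).filter fun y => ¬ s - n * (y - a) ≤ t).card +
        ((Finset.Ioc a (a + w)).filter fun y => ¬ t < s' + n * (a + w - y) + n).card) =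
      (Finset.Ioc a (a + w)).card := by
    have h := Finset.card_filter_add_card_filter_not (s := Finset.Ioc a (a + w))
      (fun y => s - n * (y - a) ≤ t ∧ t < s' + n * (a + w - y) + n)
    rw [← h]
    push_cast
    congr 1
    have h2 : (Finset.Ioc a (a + w)).filter
        (fun y => ¬ (s - n * (y - a) ≤ t ∧ t < s' + n * (a + w - y) + n)) =
        ((Finset.Ioc a (a + w)).filter fun y => ¬ s - n * (y - a) ≤ t) ∪
        ((Finset.Ioc a (a + w)).filter fun y => ¬ t < s' + n * (a + w - y) + n) := by
      rw [← Finset.filter_or]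
      exact Finset.filter_congr fun y _ => not_and_or
    rw [h2, Finset.card_union_of_disjoint hdisj]
    push_cast
    rfl
  rw [hA, hB, hcard] at hsplit
  linarith

lemma card_filter_Ioc (Y : ℕ → ℤ) (P : ℤ → Prop) [DecidablePred P] {x : ℕ}
    (hY : ∀ z < x, Y z ≤ Y (z + 1)) :
    ((Finset.Ioc (Y 0) (Y x)).filter P).card =
      ∑ z ∈ Finset.range x, ((Finset.Ioc (Y z) (Y (z + 1))).filter P).card := by
  induction x with
  | zero => simp
  | succ x ih =>
    have h0 : Y 0 ≤ Y x := by
      clear ih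
      induction x with
      | zero => exact le_rfl
      | succ x ih => exact (ih fun z hz => hY z (by omega)).trans (hY x (by omega))
    rw [Finset.sum_range_succ, ← ih fun z hz => hY z (by omega),
      ← Finset.Ioc_union_Ioc_eq_Ioc h0 (hY x (by omega)), Finset.filter_union,
      Finset.card_union_of_disjoint]
    refine Finset.disjoint_filter_filter ?_
    rw [Finset.disjoint_left]
    intro y hy hy'
    rw [Finset.mem_Ioc] at hy hy'
    omega

lemma flat_mono {y : Fin d → Fin n → ℤ} (hy : y ∈ dyckPaths d n m) {x x' : ℕ} (h : x ≤ x')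
    (hx' : x' < d * n) : flat y x ≤ flat y x' := by
  induction x', h using Nat.le_induction with
  | base => exact le_rfl
  | succ z _ ih => exact (ih (by omega)).trans (hy.2 z hx')

lemma arm_eq {y : Fin d → Fin n → ℤ} (hy : y ∈ dyckPaths d n m) {x z : ℕ} (hx : x < d * n)
    (hz : z < x) {t : ℤ} (h1 : flat y z < t) (h2 : t ≤ flat y (z + 1)) :
    arm y (x, t) = x - (z + 1) := by
  rw [arm]
  have : (Finset.range x).filter (fun x' => t ≤ flat y x') = Finset.Ico (z + 1) x := by
    ext w
    simp only [Finset.mem_filter, Finset.mem_range, Finset.mem_Ico]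
    constructor
    · rintro ⟨h3, h4⟩
      refine ⟨?_, h3⟩
      by_contra hc
      have := flat_mono hy (x := w) (x' := z) (by omega) (by omega)
      omega
    · rintro ⟨h3, h4⟩
      exact ⟨h4, h2.trans (flat_mono hy h3 (by omega))⟩
  rw [this, Nat.card_Ico]

lemma flat_zero (hd : 0 < d) (hn : 0 < n) {y : Fin d → Fin n → ℤ} (hy : y ∈ dyckPaths d n m) :
    flat y 0 = 0 := by
  have h := ((mem_dyckPaths_iff hd hn y).1 hy).1
  have hn' : (n : ℤ) ≠ 0 := by positivity
  simpa [colRank, rk, hn.ne'] using h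

/-- The boxes of column `x` are cut at the heights of the earlier columns. Between the heights of
columns `z` and `z + 1` the arm is constantly `x - (z + 1)`, and the two slope conditions at height
`t` become `rk (z, t) ≤ r x < rk (z + 1, t) + n`. -/
lemma dinv_eq_sum (hd : 0 < d) (hn : 0 < n) {y : Fin d → Fin n → ℤ} (hy : y ∈ dyckPaths d n m) :
    dinv m y = ∑ x ∈ Finset.range (d * n), ∑ z ∈ Finset.range x,
      ((Finset.Ioc (flat y z) (flat y (z + 1))).filter fun t =>
        colRank n m y z - n * (t - flat y z) ≤ colRank n m y x ∧
        colRank n m y x < colRank n m y (z + 1) + n * (flat y (z + 1) - t) + n).card := by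
  classical
  set Q : ℕ → ℤ → Prop := fun x t => n * leg y (x, t) ≤ m * (arm y (x, t) + 1) ∧
    m * arm y (x, t) < n * (leg y (x, t) + 1)
  set S : Finset (Σ _ : ℕ, ℤ) := (Finset.range (d * n)).sigma fun x =>
    (Finset.Ioc (flat y 0) (flat y x)).filter (Q x) with hS
  have himg : {z | z ∈ boxes y ∧ n * leg y z ≤ m * (arm y z + 1) ∧
      m * arm y z < n * (leg y z + 1)} = (fun s : Σ _ : ℕ, ℤ => (s.1, s.2)) '' S := by
    ext ⟨x, t⟩
    simp only [boxes, mem_ofPred_eq, hS, Finset.coe_sigma, mem_image, Sigma.exists, Prod.mk.injEq,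
      Set.mem_sigma_iff, Finset.coe_range, mem_Iio, Finset.coe_filter, Finset.mem_Ioc,
      flat_zero hd hn hy]
    constructor
    · rintro ⟨⟨h1, h2, h3⟩, h4⟩
      exact ⟨x, t, ⟨h1, ⟨by omega, h3⟩, h4⟩, rfl, rfl⟩
    · rintro ⟨x, t, ⟨h1, ⟨h2, h3⟩, h4⟩, rfl, rfl⟩
      exact ⟨⟨h1, by omega, h3⟩, h4⟩
  have hinj : InjOn (fun s : Σ _ : ℕ, ℤ => (s.1, s.2)) S := by
    rintro ⟨x, t⟩ _ ⟨x', t'⟩ _ h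
    simp only [Prod.mk.injEq] at h
    obtain ⟨rfl, rfl⟩ := h
    rfl
  rw [dinv, himg, hinj.ncard_image, Set.ncard_coe_finset, hS, Finset.card_sigma]
  refine Finset.sum_congr rfl fun x hx => ?_
  rw [Finset.mem_range] at hx
  rw [card_filter_Ioc (flat y) (Q x) fun z hz => hy.2 z (by omega)]
  refine Finset.sum_congr rfl fun z hz => ?_
  rw [Finset.mem_range] at hz
  congr 1
  refine Finset.filter_congr fun t ht => ?_
  rw [Finset.mem_Ioc] at ht
  simp only [Q, arm_eq hy hx hz ht.1 ht.2, leg, colRank, rk]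
  obtain ⟨w, rfl⟩ : ∃ w, x = z + 1 + w := ⟨x - (z + 1), by omega⟩
  rw [Nat.add_sub_cancel_left]
  push_cast
  constructor <;> rintro ⟨h1, h2⟩ <;> constructor <;> linarith

lemma stepCount_of_neg (hn : 0 < n) {t : ℤ} (ht : t ≤ 0) : stepCount n t = 0 :=
  max_eq_left (Int.ediv_nonpos_of_nonpos_of_neg ht (by positivity))

/-- In each column the count of a segment is its length, plus a telescoping difference, minus a term
of the pair `(z, x)`. The telescoping parts add up to `y_x + (⌊m x / n⌋ - y_x)`, the share of the
column in `δ`; the remaining boundary terms have nonpositive argument and vanish. So co-dinv is the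
sum of the pair terms. -/
lemma codinv_eq (hd : 0 < d) (hn : 0 < n) (hco : Nat.Coprime n m) {y : Fin d → Fin n → ℤ}
    (hy : y ∈ dyckPaths d n m) :
    codinv m y = (∑ x ∈ Finset.range (d * n), ∑ x' ∈ Finset.range (d * n),
      stepDiff n m (colRank n m y x' - colRank n m y x) 0) +
        positionSum n m (colRank n m y) (d * n) := by
  obtain ⟨hr0, hnn, -⟩ := (mem_dyckPaths_iff hd hn y).1 hy
  set r := colRank n m y with hr
  have hcol : ∀ x ∈ Finset.range (d * n), (m * x : ℤ) / n -
      ((∑ z ∈ Finset.range x, ((Finset.Ioc (flat y z) (flat y (z + 1))).filter fun t =>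
        r z - n * (t - flat y z) ≤ r x ∧
        r x < r (z + 1) + n * (flat y (z + 1) - t) + n).card : ℕ) : ℤ) =
      ∑ z ∈ Finset.range x, (stepDiff n m (r z - r x) 1 + stepDiff n m (r x - r z) 0) := by
    intro x hx
    rw [Finset.mem_range] at hx
    push_cast
    have hseg : ∀ z ∈ Finset.range x, (((Finset.Ioc (flat y z) (flat y (z + 1))).filter fun t =>
        r z - n * (t - flat y z) ≤ r x ∧
        r x < r (z + 1) + n * (flat y (z + 1) - t) + n).card : ℤ) =
        (flat y (z + 1) - flat y z) +
          ((stepCount n (r (z + 1) - m - r x - 1) - stepCount n (r x - r (z + 1))) -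
          (stepCount n (r z - m - r x - 1) - stepCount n (r x - r z))) -
          (stepDiff n m (r z - r x) 1 + stepDiff n m (r x - r z) 0) := by
      intro z hz
      rw [Finset.mem_range] at hz
      rw [card_segment (m := m) hn (hy.2 z (by omega)) (by
        simp only [hr, colRank, rk]
        push_cast
        ring)]
      simp only [stepDiff, sub_zero]
      rw [show r z - r x - m - 1 = r z - m - r x - 1 by ring,
        show r x - r z - m = r x - r z - m from rfl]
      ring
    rw [Finset.sum_congr rfl hseg, Finset.sum_sub_distrib, Finset.sum_add_distrib,
      Finset.sum_range_sub, Finset.sum_range_sub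
        (fun z => stepCount n (r z - m - r x - 1) - stepCount n (r x - r z)),
      flat_zero hd hn hy, hr0]
    have h1 := stepCount_colRank hn (hnn x hx)
    have hxr := hnn x hx
    rw [sub_zero, stepCount_of_neg hn (by omega : r x - m - r x - 1 ≤ 0),
      stepCount_of_neg hn (by omega : r x - r x ≤ 0),
      stepCount_of_neg hn (by omega : 0 - (m : ℤ) - r x - 1 ≤ 0), sub_zero, sub_zero, h1]
    ring
  have hall : ∑ x ∈ Finset.range (d * n), ∑ x' ∈ Finset.range (d * n),
      stepDiff n m (r x' - r x) 0 = ∑ x ∈ Finset.range (d * n), ∑ z ∈ Finset.range x,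
        (stepDiff n m (r z - r x) 0 + stepDiff n m (r x - r z) 0) := by
    generalize d * n = L
    induction L with
    | zero => simp
    | succ L ih =>
      have hdiag : stepDiff n m (r L - r L) 0 = 0 := by
        rw [stepDiff, stepCount_of_neg hn (by omega), stepCount_of_neg hn (by omega), sub_zero]
      rw [Finset.sum_range_succ _ L, Finset.sum_range_succ _ L, Finset.sum_range_succ _ L, ← ih]
      simp only [Finset.sum_range_succ, Finset.sum_add_distrib, hdiag]
      ring
  rw [codinv, delta_eq hd hn hco, dinv_eq_sum hd hn hy]
  push_cast at hcol ⊢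
  rw [← Finset.sum_sub_distrib, Finset.sum_congr rfl hcol, hall, positionSum,
    ← Finset.sum_add_distrib]
  refine Finset.sum_congr rfl fun x hx => ?_
  rw [sum_range_ite_lt _ (Finset.mem_range.1 hx).le, ← Finset.sum_add_distrib]
  refine Finset.sum_congr rfl fun z _ => ?_
  rw [orderTerm]
  ring

end

section

/-! ### The statistics of a Dyck path and its image -/

variable {d n m : ℕ} {p : ℕ → ℕ} {q r : ℕ → ℤ} {V : ℕ → ℕ → ℤ}

lemma residueSeq_tower (hn : 0 < n) (p : ℕ → ℕ) (hq : ResidueSeq n m (d * n) q) {u : ℕ}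
    (hu : u < d) : ResidueSeq n m (d * n) (tower n p q u) := by
  intro x hx
  have h1 := hq.congr_mod (tower_index_lt n p hu hx)
  rw [mul_add_mod_self (Nat.mod_lt x hn)] at h1
  have h2 : ((x : ℕ) : ℤ) = (x / n : ℕ) * n + (x % n : ℕ) := by
    exact_mod_cast (div_mul_add_mod n x).symm
  rw [tower, h2]
  exact dvd_trans_eq (dvd_sub h1 (dvd_mul_right (n : ℤ) (m * (x / n : ℕ)))) (by ring)

lemma psi_eq_layerSet (y : Fin d → Fin n → ℤ) :
    psi d n m y = layerSet d n (colRank n m (psiMatrix d n m y)) := toSubset_eq_layerSet m _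

/-- The ranks of a path and of its image form the same multiset, which settles every statistic that
ignores the order. -/
lemma sum_psiMatrix (hd : 0 < d) (hn : 0 < n) {y : Fin d → Fin n → ℤ}
    (hy : y ∈ dyckPaths d n m) (f : ℤ → ℤ) :
    ∑ x ∈ Finset.range (d * n), f (colRank n m y x) =
      ∑ x ∈ Finset.range (d * n), f (colRank n m (psiMatrix d n m y) x) := by
  have h := (layeredPath_psiTower hd hn hy).sum_eq hn f (u := d - 1) (L := d) (by omega) (by omega)
  rw [psiTower_zero] at h
  rw [← h]
  refine Finset.sum_congr rfl fun x hx => ?_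
  rw [psiTower, tower_psiMatrix hd y (Finset.mem_range.1 hx)]

lemma size_psiMatrix (hd : 0 < d) (hn : 0 < n) {y : Fin d → Fin n → ℤ}
    (hy : y ∈ dyckPaths d n m) : size (psiMatrix d n m y) = size y := by
  have h := sum_psiMatrix hd hn hy id
  simp only [id, colRank, rk, Finset.sum_sub_distrib, ← Finset.mul_sum] at h
  have hn' : (n : ℤ) ≠ 0 := by positivity
  rw [size_eq, size_eq]
  exact mul_left_cancel₀ hn' (by linarith)

lemma dimSub_psi (hd : 0 < d) (hn : 0 < n) (hco : Nat.Coprime n m) {y : Fin d → Fin n → ℤ}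
    (hy : y ∈ dyckPaths d n m) : dimSub d n m (psi d n m y) = codinv m y := by
  have hV := layeredPath_psiTower hd hn hy
  have hq := admissibleSeq_psiMatrix hd hn hy
  rw [psi_eq_layerSet, dimSub_layerSet_eq hd hn hco hq.residue hq.nonneg, codinv_eq hd hn hco hy]
  congr 1
  · rw [← sum_psiMatrix hd hn hy (fun t => ∑ x' ∈ Finset.range (d * n),
      stepDiff n m (colRank n m (psiMatrix d n m y) x' - t) 0)]
    refine Finset.sum_congr rfl fun x _ => ?_
    exact (sum_psiMatrix hd hn hy (fun t => stepDiff n m (t - colRank n m y x) 0)).symm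
  · have h := hV.positionSum_eq hn hco (fun u hu => residueSeq_tower hn _ hq.residue hu)
      (u := d - 1) (by omega)
    rw [Nat.sub_add_cancel hd, psiTower_zero] at h
    rw [← h, positionSum, positionSum]
    refine Finset.sum_congr rfl fun x hx => Finset.sum_congr rfl fun x' hx' => ?_
    rw [psiTower, tower_psiMatrix hd y (Finset.mem_range.1 hx),
      tower_psiMatrix hd y (Finset.mem_range.1 hx')]

/-! ### The enhanced rank -/

/-- The position of the generator of the image that belongs to the column `x`. -/
noncomputable def genIndex (d n m : ℕ) (y : Fin d → Fin n → ℤ) (x : ℕ) : ℕ :=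
  (sPerm d n m y (x % n))⁻¹ (x / n) * n + x % n

lemma genIndex_lt (y : Fin d → Fin n → ℤ) {x : ℕ} (hx : x < d * n) :
    genIndex d n m y x < d * n :=
  tower_index_lt n _ (Nat.sub_lt (Nat.zero_lt_of_lt (div_lt hx)) one_pos) hx

lemma genIndex_injective (hn : 0 < n) (y : Fin d → Fin n → ℤ) :
    Function.Injective (genIndex d n m y) := by
  intro x x' h
  have h1 := Nat.mod_lt x hn
  have h2 := Nat.mod_lt x' hn
  have hmod : x % n = x' % n := by
    rw [← mul_add_mod_self (i := (sPerm d n m y (x % n))⁻¹ (x / n)) h1,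
      ← mul_add_mod_self (i := (sPerm d n m y (x' % n))⁻¹ (x' / n)) h2]
    exact congrArg (· % n) h
  have hdiv : (sPerm d n m y (x % n))⁻¹ (x / n) = (sPerm d n m y (x' % n))⁻¹ (x' / n) := by
    rw [← mul_add_div_self (i := (sPerm d n m y (x % n))⁻¹ (x / n)) h1,
      ← mul_add_div_self (i := (sPerm d n m y (x' % n))⁻¹ (x' / n)) h2]
    exact congrArg (· / n) h
  rw [hmod] at hdiv
  rw [← div_mul_add_mod n x, ← div_mul_add_mod n x', hmod, (Equiv.injective _) hdiv]

lemma exists_genIndex (hn : 0 < n) (y : Fin d → Fin n → ℤ) {x : ℕ} (hx : x < d * n) :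
    ∃ x' < d * n, genIndex d n m y x' = x := by
  have h1 := Nat.mod_lt x hn
  have h2 := div_lt hx
  refine ⟨_, mul_add_lt (permComp_lt n (moveIndex d n m y) (x % n) (k := d - 1)
    (Nat.sub_lt (Nat.zero_lt_of_lt h2) one_pos) h2) h1,
    ?_⟩
  rw [genIndex, mul_add_mod_self h1, mul_add_div_self h1, sPerm, perm_inv_apply, div_mul_add_mod]

/-- Column `x` is the progression of a single generator of the image, and the coordinate of a point
in it is its depth `y_x - y` below the top of the diagram. Membership in the image is thus
nonnegativity of the depth. -/
lemma enhancedRank_eq (hd : 0 < d) (y : Fin d → Fin n → ℤ) {z : ℕ × ℤ} (hz : z.1 < d * n) :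
    enhancedRank d n m y z = d * (colRank n m (psiMatrix d n m y) (genIndex d n m y z.1) +
      n * (flat y z.1 - z.2)) + (genIndex d n m y z.1 / n : ℕ) := by
  have hn := pos_of_lt_mul hz
  have h : colRank n m (psiMatrix d n m y) (genIndex d n m y z.1) = colRank n m y z.1 :=
    tower_psiMatrix hd y hz
  rw [h, genIndex, mul_add_div_self (Nat.mod_lt _ hn), enhancedRank]
  simp only [colRank, rk]
  ring

lemma enhancedRank_ediv (hd : 0 < d) (y : Fin d → Fin n → ℤ) {z : ℕ × ℤ}
    (hz : z.1 < d * n) : enhancedRank d n m y z / (d : ℤ) = rk n m z := by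
  have hd' : (0 : ℤ) < d := by exact_mod_cast hd
  have hlt : (((sPerm d n m y (z.1 % n))⁻¹ (z.1 / n) : ℕ) : ℤ) < d := by
    exact_mod_cast permComp_inv_lt n (moveIndex d n m y) (z.1 % n) (k := d - 1) (by omega)
      (div_lt hz)
  rw [enhancedRank, add_comm, Int.add_mul_ediv_left _ _ hd'.ne',
    Int.ediv_eq_zero_of_lt (by positivity) hlt, zero_add]

lemma enhancedRank_nonneg_iff (hd : 0 < d) (y : Fin d → Fin n → ℤ) {z : ℕ × ℤ}
    (hz : z.1 < d * n) : 0 ≤ enhancedRank d n m y z ↔ (n : ℤ) * z.2 ≤ m * z.1 := by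
  have hd' : (0 : ℤ) < d := by exact_mod_cast hd
  rw [← Int.ediv_nonneg_iff_of_pos hd', enhancedRank_ediv hd y hz, rk, sub_nonneg]

lemma exists_enhancedRank_eq (hd : 0 < d) (hn : 0 < n) (hco : Nat.Coprime n m)
    (y : Fin d → Fin n → ℤ) (b : ℤ) : ∃ z : ℕ × ℤ, z.1 < d * n ∧ enhancedRank d n m y z = b := by
  obtain ⟨x, hx, k, hk⟩ :=
    (colRank_residueSeq n m (d * n) (psiMatrix d n m y)).exists_coord hd hn hco b
  obtain ⟨x', hx', rfl⟩ := exists_genIndex (m := m) hn y hx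
  refine ⟨(x', flat y x' - k), hx', ?_⟩
  rw [enhancedRank_eq hd y hx', hk]
  ring

lemma enhancedRank_bijOn (hd : 0 < d) (hn : 0 < n) (hco : Nat.Coprime n m)
    (y : Fin d → Fin n → ℤ) :
    BijOn (enhancedRank d n m y) (extendedRegion d n m) {k : ℤ | 0 ≤ k} := by
  refine ⟨fun z hz => (enhancedRank_nonneg_iff hd y hz.1).2 hz.2, ?_, ?_⟩
  · rintro ⟨x, t⟩ hz ⟨x', t'⟩ hz' h
    rw [enhancedRank_eq hd y hz.1, enhancedRank_eq hd y hz'.1] at h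
    obtain ⟨h1, h2⟩ := (colRank_residueSeq n m (d * n) (psiMatrix d n m y)).coord_unique hco
      (genIndex_lt y hz.1) (genIndex_lt y hz'.1) h
    obtain rfl : x = x' := genIndex_injective hn y h1
    simp only [Prod.mk.injEq, true_and]
    simp only at h2
    omega
  · intro b hb
    obtain ⟨z, hz, rfl⟩ := exists_enhancedRank_eq (m := m) hd hn hco y b
    exact ⟨z, ⟨hz, (enhancedRank_nonneg_iff hd y hz).1 hb⟩, rfl⟩

lemma mem_psi_iff (hd : 0 < d) (hco : Nat.Coprime n m) (y : Fin d → Fin n → ℤ)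
    {z : ℕ × ℤ} (hz : z.1 < d * n) {b : ℕ} (hb : enhancedRank d n m y z = b) :
    b ∈ psi d n m y ↔ z.2 ≤ flat y z.1 := by
  rw [psi_eq_layerSet, coord_mem_layerSet hco (colRank_residueSeq n m (d * n) _)
    (genIndex_lt y hz) (by rw [← hb, enhancedRank_eq hd y hz]), sub_nonneg]

lemma enhancedRank_image (hd : 0 < d) (hn : 0 < n) (hco : Nat.Coprime n m)
    {y : Fin d → Fin n → ℤ} (hy : y ∈ dyckPaths d n m) :
    enhancedRank d n m y '' (trianglePlus d n m \ boxes y) =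
      (fun k : ℕ => (k : ℤ)) '' (psi d n m y)ᶜ := by
  ext b
  constructor
  · rintro ⟨z, ⟨⟨h1, h2, h3⟩, h4⟩, rfl⟩
    obtain ⟨b, hb⟩ := Int.eq_ofNat_of_zero_le ((enhancedRank_nonneg_iff hd y h1).2 h3)
    refine ⟨b, ?_, hb.symm⟩
    rw [mem_compl_iff, mem_psi_iff hd hco y h1 hb]
    exact fun h => h4 ⟨h1, h2, h⟩
  · rintro ⟨b, hb, rfl⟩
    obtain ⟨z, hz, h⟩ := exists_enhancedRank_eq (m := m) hd hn hco y (b : ℤ)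
    rw [mem_compl_iff, mem_psi_iff hd hco y hz h, not_le] at hb
    -- A gap lies strictly above the path, whose heights are nonnegative; this yields `1 ≤ y`, so
    -- the point lies in the triangle.
    have h0 := flat_mono hy (Nat.zero_le z.1) hz
    rw [flat_zero hd hn hy] at h0
    refine ⟨z, ⟨⟨hz, by omega, (enhancedRank_nonneg_iff hd y hz).1 (by omega)⟩, ?_⟩, h⟩
    rintro ⟨-, -, hle⟩
    omega

/-! ### The bijection -/

lemma psi_mem_admissibleSubsets (hd : 0 < d) (hn : 0 < n) (hco : Nat.Coprime n m)
    {y : Fin d → Fin n → ℤ} (hy : y ∈ dyckPaths d n m) :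
    psi d n m y ∈ admissibleSubsets d n m := by
  rw [mem_admissibleSubsets_iff hd hn hco, psi_eq_layerSet]
  exact (admissibleSeq_psiMatrix hd hn hy).isInvariantAdmissible hd hn hco

lemma toMatrix_psi (hd : 0 < d) (hn : 0 < n) (hco : Nat.Coprime n m)
    {y : Fin d → Fin n → ℤ} (hy : y ∈ dyckPaths d n m) :
    toMatrix d n m (psi d n m y) = psiMatrix d n m y :=
  toMatrix_toSubset hco _ (admissibleSeq_psiMatrix hd hn hy).nonneg

lemma phi_psi (hd : 0 < d) (hn : 0 < n) (hco : Nat.Coprime n m)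
    {y : Fin d → Fin n → ℤ} (hy : y ∈ dyckPaths d n m) : phi d n m (psi d n m y) = y := by
  rw [phi, toMatrix_psi hd hn hco hy, phiMatrix_psiMatrix hd hn hy]

lemma psi_phi (hd : 0 < d) (hn : 0 < n) (hco : Nat.Coprime n m) {Δ : Set ℕ}
    (hΔ : Δ ∈ admissibleSubsets d n m) : psi d n m (phi d n m Δ) = Δ := by
  rw [mem_admissibleSubsets_iff hd hn hco] at hΔ
  rw [psi_eq_layerSet, phi, psiMatrix_phiMatrix hd hn (hΔ.admissibleSeq hd hn hco),
    hΔ.layerSet_toMatrix hd hn hco]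

lemma phi_mem_dyckPaths (hd : 0 < d) (hn : 0 < n) (hco : Nat.Coprime n m) {Δ : Set ℕ}
    (hΔ : Δ ∈ admissibleSubsets d n m) : phi d n m Δ ∈ dyckPaths d n m := by
  rw [mem_admissibleSubsets_iff hd hn hco] at hΔ
  exact phiMatrix_mem_dyckPaths hd hn (hΔ.admissibleSeq hd hn hco)

lemma LayeredPath.strictMono (hV : LayeredPath d n m p V) {u v : ℕ} (hu : 1 ≤ u) (huv : u < v)
    (hv : v < d) : p u < p v := by
  induction v, huv using Nat.le_induction with
  | base =>
    obtain ⟨w, rfl⟩ : ∃ w, u = w + 1 := ⟨u - 1, by omega⟩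
    exact hV.lt w hv
  | succ v hle ih =>
    obtain ⟨w, rfl⟩ : ∃ w, v = w + 1 := ⟨v - 1, by omega⟩
    exact (ih (by omega)).trans (hV.lt w hv)

end

end DyckAdm

theorem mainTheorem3 (d n m : ℕ) (hd : 0 < d) (hn : 0 < n) (hnm : n < m) (hco : Nat.Coprime n m) :
    -- the move indices are well defined, and `0 < p_1 < ⋯ < p_{d-1} ≤ (d-1)n`
    (∀ y ∈ DyckAdm.dyckPaths d n m,
      (∀ u, 1 ≤ u → u < d →
        IsGreatest (DyckAdm.moveSet n m (DyckAdm.rankVec d n m y (d - u - 1)) u)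
          (DyckAdm.moveIndex d n m y u)) ∧
      (∀ u, 1 ≤ u → u < d → 0 < DyckAdm.moveIndex d n m y u ∧
        DyckAdm.moveIndex d n m y u ≤ (d - 1) * n) ∧
      (∀ u v, 1 ≤ u → u < v → v < d →
        DyckAdm.moveIndex d n m y u < DyckAdm.moveIndex d n m y v)) ∧
    -- `Adm(dn,dm)` is the set of admissible `(dn,dm)`-invariant subsets with minimum `0`, and
    -- their matrices and move indices (on which `Φ_d` rests) are well defined
    (∀ Δ : Set ℕ, Δ ∈ DyckAdm.admissibleSubsets d n m ↔
      0 ∈ Δ ∧ (∀ b ∈ Δ, b + d * n ∈ Δ ∧ b + d * m ∈ Δ) ∧ DyckAdm.IsAdmissible d n m Δ) ∧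
    (∀ Δ ∈ DyckAdm.admissibleSubsets d n m,
      ((fun a : ℕ => (a : ℤ)) '' DyckAdm.generators (d * n) Δ =
        {b | ∃ (i : Fin d) (j : Fin n),
          b = DyckAdm.aHat d n m i j - d * n * DyckAdm.toMatrix d n m Δ i j}) ∧
      ∀ u, 1 ≤ u → u < d →
        IsGreatest
          (DyckAdm.tildeMoveSet n m
            (DyckAdm.tildeRankVec d n m (DyckAdm.toMatrix d n m Δ) (u - 1)) u)
          (DyckAdm.tildeMoveIndex d n m (DyckAdm.toMatrix d n m Δ) u)) ∧
    -- `Ψ_d` is a bijection with inverse `Φ_d`, compatible with the statistics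
    Set.BijOn (DyckAdm.psi d n m) (DyckAdm.dyckPaths d n m) (DyckAdm.admissibleSubsets d n m) ∧
    Set.InvOn (DyckAdm.phi d n m) (DyckAdm.psi d n m)
      (DyckAdm.dyckPaths d n m) (DyckAdm.admissibleSubsets d n m) ∧
    (∀ y ∈ DyckAdm.dyckPaths d n m,
      DyckAdm.toMatrix d n m (DyckAdm.psi d n m y) = DyckAdm.psiMatrix d n m y ∧
      DyckAdm.eInv d n m (DyckAdm.psi d n m y) = DyckAdm.size (DyckAdm.psiMatrix d n m y) ∧
      DyckAdm.size (DyckAdm.psiMatrix d n m y) = DyckAdm.size y ∧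
      DyckAdm.dimSub d n m (DyckAdm.psi d n m y) = DyckAdm.codinv m y) ∧
    -- the enhanced rank
    (∀ y ∈ DyckAdm.dyckPaths d n m,
      Set.BijOn (DyckAdm.enhancedRank d n m y) (DyckAdm.extendedRegion d n m) {k : ℤ | 0 ≤ k} ∧
      (∀ z ∈ DyckAdm.extendedRegion d n m,
        DyckAdm.enhancedRank d n m y z / (d : ℤ) = DyckAdm.rk n m z) ∧
      DyckAdm.enhancedRank d n m y '' (DyckAdm.trianglePlus d n m \ DyckAdm.boxes y) =
        (fun k : ℕ => (k : ℤ)) '' (DyckAdm.psi d n m y)ᶜ) := by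
  refine ⟨?_, fun Δ => DyckAdm.mem_admissibleSubsets_iff hd hn hco, ?_, ?_, ?_, ?_, ?_⟩
  · intro y hy
    have hV := DyckAdm.layeredPath_psiTower hd hn hy
    refine ⟨?_, ?_, fun u v hu huv hv => hV.strictMono hu huv hv⟩
    · intro u hu hud
      obtain ⟨u, rfl⟩ : ∃ w, u = w + 1 := ⟨u - 1, by omega⟩
      rw [DyckAdm.moveSet_congr hn (DyckAdm.rankVec_eq_psiTower hd hn y (by omega))]
      exact hV.move u hud
    · intro u hu hud
      obtain ⟨u, rfl⟩ : ∃ w, u = w + 1 := ⟨u - 1, by omega⟩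
      exact ⟨hV.pos u hud, (DyckAdm.moveIndex_le y (u + 1)).trans
        (Nat.mul_le_mul_right _ (by omega))⟩
  · intro Δ hΔ
    rw [DyckAdm.mem_admissibleSubsets_iff hd hn hco] at hΔ
    have hq := hΔ.admissibleSeq hd hn hco
    refine ⟨?_, ?_⟩
    · have h := DyckAdm.layerSet_generators_image hn hco hq.nonneg
      rwa [hΔ.layerSet_toMatrix hd hn hco] at h
    · intro u hu hud
      obtain ⟨u, rfl⟩ : ∃ w, u = w + 1 := ⟨u - 1, by omega⟩
      rw [Nat.add_sub_cancel, DyckAdm.tildeRankVec_eq_tower hn]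
      exact (DyckAdm.layeredPath_phiTower hn hq).tilde u hud
  · exact Set.InvOn.bijOn ⟨fun y hy => DyckAdm.phi_psi hd hn hco hy,
      fun Δ hΔ => DyckAdm.psi_phi hd hn hco hΔ⟩
      (fun y hy => DyckAdm.psi_mem_admissibleSubsets hd hn hco hy)
      (fun Δ hΔ => DyckAdm.phi_mem_dyckPaths hd hn hco hΔ)
  · exact ⟨fun y hy => DyckAdm.phi_psi hd hn hco hy, fun Δ hΔ => DyckAdm.psi_phi hd hn hco hΔ⟩
  · intro y hy
    refine ⟨DyckAdm.toMatrix_psi hd hn hco hy, ?_, DyckAdm.size_psiMatrix hd hn hy,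
      DyckAdm.dimSub_psi hd hn hco hy⟩
    rw [DyckAdm.psi_eq_layerSet]
    exact DyckAdm.eInv_layerSet hd hn hco (DyckAdm.admissibleSeq_psiMatrix hd hn hy).nonneg
  · intro y hy
    exact ⟨DyckAdm.enhancedRank_bijOn hd hn hco y,
      fun z hz => DyckAdm.enhancedRank_ediv hd y hz.1,
      DyckAdm.enhancedRank_image hd hn hco hy⟩
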